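/- **Theorem 1 (Completeness of Friedmann universes).** Let $\mathcal M$ be a smooth $n$-manifold with a smooth Riemannian metric $d\sigma^2$ of constant curvature $k$, let $t_0\in\mathbb R$, and let $a:(t_0,\infty)\to(0,\infty)$ be smooth. Consider the Friedmann spacetime $\mathcal V=\mathcal M\times(t_0,\infty)$ with metric $$-dt^2+a(t)^2\,d\sigma^2,$$ time-oriented by increasing $t$; it is the sliced space with lapse $N=1$, shift $\beta=0$ and spatial metric $g_t=a(t)^2d\sigma^2$. Suppose that 1. $\mathcal V$ is globally hyperbolic, i.e. it has no closed causal curves and all causal diamonds $J^+(p)\cap J^-(q)$ are compact; 2. $\mathcal V$ is regularly hyperbolic, i.e. its lapse, shift and spatial metric are uniformly bounded: there are constants with $0<N_1\le N\le N_2$ and $|\beta|_{g_t}^2\le B$, and there are a smooth Riemannian metric $\gamma$ on $\mathcal M$ and constants $A,D>0$ with $A\gamma\le g_t\le D\gamma$ for all $t>t_0$ (the conditions on $N$ and $\beta$ hold trivially here); 3. for each finite $t_1>t_0$ there is a function $f$, integrable on $[t_1,\infty)$, such that the Hubble expansion rate $H=\dot a/a$ satisfies $|H(t)|\le f(t)$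 for all $t\ge t_1$. Then $\mathcal V$ is future timelike and null geodesically complete: every geodesic whose initial velocity is a future-directed timelike or future-directed null vector can be extended to all positive values of its affine parameter. -/

import Mathlib

open scoped Manifold ContDiff
open Set

noncomputable section

namespace Friedmann

/-! ## Metric fields, Christoffel symbols and geodesics -/

section General

variable {E : Type*} [NormedAddCommGroup E] [NormedSpace ℝ E]
  {H : Type*} [TopologicalSpace H] (I : ModelWithCorners ℝ E H)
  {V : Type*} [TopologicalSpace V] [ChartedSpace H V]

variable (V) in
/-- A field `g` of scalar-valued forms `g p : T_p V × T_p V → ℝ` on the manifold `V`.  It is used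
below only for fields of symmetric bilinear forms (Riemannian or Lorentzian metrics). -/
abbrev FormField : Type _ :=
  ∀ p : V, TangentSpace I p → TangentSpace I p → ℝ

variable (V) in
/-- A one-form on the manifold `V`. -/
abbrev OneForm : Type _ := ∀ p : V, TangentSpace I p → ℝ

variable {I}

/-- The expression of `g` in the chart at `p₀`: its pull-back under the inverse of that chart,
as a function of the coordinate point `y` and of two coordinate vectors `u`, `v`. -/
def inChart (g : FormField I V) (p₀ : V) (y u v : E) : ℝ :=
  g ((extChartAt I p₀).symm y)
    (mfderiv 𝓘(ℝ, E) I (extChartAt I p₀).symm y u)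
    (mfderiv 𝓘(ℝ, E) I (extChartAt I p₀).symm y v)

/-- Christoffel symbols of the first kind of a metric `G` given in coordinates:
`[uv, w] = (D_u G(v, w) + D_v G(u, w) - D_w G(u, v)) / 2` for constant vectors `u`, `v`, `w`. -/
def christoffel₁ (G : E → E → E → ℝ) (y u v w : E) : ℝ :=
  (fderiv ℝ (fun z ↦ G z v w) y u + fderiv ℝ (fun z ↦ G z u w) y v
    - fderiv ℝ (fun z ↦ G z u v) y w) / 2

/-- `γ` is an (affinely parametrised) geodesic of `g` on the open set `s` of parameters: it is
`C²` there and, in every chart, its coordinate expression `c` satisfies the geodesic equation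
`g_{lm} c''^m + Γ_{l,jk} c'^j c'^k = 0`. -/
def IsGeodesicOn (g : FormField I V) (γ : ℝ → V) (s : Set ℝ) : Prop :=
  ContMDiffOn 𝓘(ℝ, ℝ) I 2 γ s ∧
  ∀ p₀ : V, ∀ r ∈ s, γ r ∈ (extChartAt I p₀).source →
    ∀ w : E,
      inChart g p₀ (extChartAt I p₀ (γ r)) (deriv (deriv (fun x ↦ extChartAt I p₀ (γ x))) r) w
        + christoffel₁ (inChart g p₀) (extChartAt I p₀ (γ r))
            (deriv (fun x ↦ extChartAt I p₀ (γ x)) r)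
            (deriv (fun x ↦ extChartAt I p₀ (γ x)) r) w = 0

variable (I) in
/-- The velocity of a curve, as an element of the tangent bundle. -/
def velocity (γ : ℝ → V) (r : ℝ) : TangentBundle I V :=
  ⟨γ r, mfderiv 𝓘(ℝ, ℝ) I γ r (1 : ℝ)⟩

/-- `g` has constant sectional curvature `k`: in every chart, with `Γ` the Christoffel symbols of
the second kind (`g(Γ(u, v), w) = [uv, w]`), the curvature tensor
`R(u,v)w = D_u Γ(v,w) - D_v Γ(u,w) + Γ(u, Γ(v,w)) - Γ(v, Γ(u,w))` is
`k (g(v,w) u - g(u,w) v)`. -/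
def HasConstantCurvature (g : FormField I V) (k : ℝ) : Prop :=
  ∀ p₀ : V, ∃ Γ : E → E → E → E,
    (∀ y ∈ (extChartAt I p₀).target, ∀ u v w : E,
      inChart g p₀ y (Γ y u v) w = christoffel₁ (inChart g p₀) y u v w) ∧
    (∀ y ∈ (extChartAt I p₀).target, ∀ u v w : E,
      fderiv ℝ (fun z ↦ Γ z v w) y u - fderiv ℝ (fun z ↦ Γ z u w) y v
          + Γ y u (Γ y v w) - Γ y v (Γ y u w)
        = k • (inChart g p₀ y v w • u - inChart g p₀ y u w • v))

/-! ## Causality and completeness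

The time orientation is given by a one-form `θ` that does not vanish on nonzero causal vectors:
a causal vector `X` is future directed if `θ X > 0`. -/

/-- Future-directed timelike vectors. -/
def IsFutureTimelike (g : FormField I V) (θ : OneForm I V) (X : TangentBundle I V) : Prop :=
  g X.1 X.2 X.2 < 0 ∧ 0 < θ X.1 X.2

/-- Future-directed null vectors. -/
def IsFutureNull (g : FormField I V) (θ : OneForm I V) (X : TangentBundle I V) : Prop :=
  g X.1 X.2 X.2 = 0 ∧ 0 < θ X.1 X.2

/-- Future-directed causal vectors. -/
def IsFutureCausal (g : FormField I V) (θ : OneForm I V) (X : TangentBundle I V) : Prop :=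
  g X.1 X.2 X.2 ≤ 0 ∧ 0 < θ X.1 X.2

/-- `p` and `q` are the endpoints of a `C¹` future-directed causal curve on `[0, 1]`. -/
def CausalArc (g : FormField I V) (θ : OneForm I V) (p q : V) : Prop :=
  ∃ γ : ℝ → V, γ 0 = p ∧ γ 1 = q ∧
    ∀ r ∈ Icc (0 : ℝ) 1, ContMDiffAt 𝓘(ℝ, ℝ) I 1 γ r ∧ IsFutureCausal g θ (velocity I γ r)

/-- The causal relation `p ≤ q`: `p = q`, or there is a piecewise `C¹` future-directed causal
curve from `p` to `q`. -/
def CausallyPrecedes (g : FormField I V) (θ : OneForm I V) : V → V → Prop :=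
  Relation.ReflTransGen (CausalArc g θ)

/-- Global hyperbolicity: there is no closed causal curve, and all causal diamonds
`J⁺(p) ∩ J⁻(q)` are compact. -/
def GloballyHyperbolic (g : FormField I V) (θ : OneForm I V) : Prop :=
  (∀ p, ¬ Relation.TransGen (CausalArc g θ) p p) ∧
  ∀ p q, IsCompact {z | CausallyPrecedes g θ p z ∧ CausallyPrecedes g θ z q}

/-- The geodesic with initial velocity `X` is defined for all nonnegative values of its affine
parameter (in fact on an open interval that contains `[0, ∞)`). -/
def GeodesicForever (g : FormField I V) (X : TangentBundle I V) : Prop :=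
  ∃ ε > (0 : ℝ), ∃ γ : ℝ → V, IsGeodesicOn g γ (Ioi (-ε)) ∧ velocity I γ 0 = X

/-- Every future-directed timelike geodesic extends to all positive affine parameters. -/
def FutureTimelikeComplete (g : FormField I V) (θ : OneForm I V) : Prop :=
  ∀ X : TangentBundle I V, IsFutureTimelike g θ X → GeodesicForever g X

/-- Every future-directed null geodesic extends to all positive affine parameters. -/
def FutureNullComplete (g : FormField I V) (θ : OneForm I V) : Prop :=
  ∀ X : TangentBundle I V, IsFutureNull g θ X → GeodesicForever g X

end General

/-! ## Sliced spaces -/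

/-- The time axis `(t₀, ∞)`, as an open submanifold of `ℝ`. -/
def timeAxis (t₀ : ℝ) : TopologicalSpace.Opens ℝ := ⟨Ioi t₀, isOpen_Ioi⟩

section Slice

variable {E : Type*} [NormedAddCommGroup E] [NormedSpace ℝ E]
  {H : Type*} [TopologicalSpace H] (I : ModelWithCorners ℝ E H)
  (M : Type*) [TopologicalSpace M] [ChartedSpace H M]

/-- Lapse, shift and time-dependent spatial metric on `M × (t₀, ∞)`. -/
structure SliceData (t₀ : ℝ) where
  /-- the lapse function `N` -/
  lapse : M × timeAxis t₀ → ℝ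
  /-- the shift vector field `β` -/
  shift : ∀ p : M × timeAxis t₀, TangentSpace I p.1
  /-- the spatial metric `g_t` at `x`, for `p = (x, t)` -/
  spatial : ∀ p : M × timeAxis t₀, TangentSpace I p.1 → TangentSpace I p.1 → ℝ

variable {I M} {t₀ : ℝ}

/-- The component along `M` of a tangent vector of `M × (t₀, ∞)`. -/
def dx (p : M × timeAxis t₀) (X : TangentSpace (I.prod 𝓘(ℝ, ℝ)) p) : TangentSpace I p.1 :=
  (show E × ℝ from X).1

variable (I M t₀) in
/-- The one-form `dt` on `M × (t₀, ∞)`; it is the time orientation by increasing `t`. -/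
def dt : OneForm (I.prod 𝓘(ℝ, ℝ)) (M × timeAxis t₀) :=
  fun _ X ↦ (show E × ℝ from X).2

/-- The spacetime metric `-N² dt² + g_{ij} (dxⁱ + βⁱ dt) (dxʲ + βʲ dt)`. -/
def SliceData.metric (S : SliceData I M t₀) :
    FormField (I.prod 𝓘(ℝ, ℝ)) (M × timeAxis t₀) :=
  fun p X Y ↦ -(S.lapse p) ^ 2 * (dt I M t₀ p X * dt I M t₀ p Y)
    + S.spatial p (dx p X + dt I M t₀ p X • S.shift p) (dx p Y + dt I M t₀ p Y • S.shift p)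

/-- Regular hyperbolicity: lapse (above and away from zero), shift and spatial metric (above and
below, as a quadratic form, against a fixed Riemannian metric `γ` on `M`) are uniformly bounded. -/
def SliceData.RegularlyHyperbolic [IsManifold I ∞ M] (S : SliceData I M t₀) : Prop :=
  (∃ N₁ N₂ : ℝ, 0 < N₁ ∧ ∀ p, N₁ ≤ S.lapse p ∧ S.lapse p ≤ N₂) ∧
  (∃ B : ℝ, ∀ p, S.spatial p (S.shift p) (S.shift p) ≤ B) ∧
  (∃ γ : Bundle.ContMDiffRiemannianMetric I ∞ E (fun x : M ↦ TangentSpace I x),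
    ∃ A D : ℝ, 0 < A ∧ 0 < D ∧ ∀ (p : M × timeAxis t₀) (v : TangentSpace I p.1),
      A * γ.inner p.1 v v ≤ S.spatial p v v ∧ S.spatial p v v ≤ D * γ.inner p.1 v v)

end Slice

/-! ## Friedmann universes -/

/-- A Friedmann universe over the smooth `n`-manifold `M`: a positive smooth scale factor `a` on
`(t₀, ∞)` and a smooth Riemannian metric `σ` of constant curvature `k` on `M`. -/
structure Universe (n : ℕ) (M : Type*) [TopologicalSpace M]
    [ChartedSpace (EuclideanSpace ℝ (Fin n)) M] [IsManifold (𝓡 n) ∞ M] where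
  /-- the left end of the time axis -/
  t₀ : ℝ
  /-- the scale factor -/
  a : ℝ → ℝ
  a_smooth : ContDiffOn ℝ ∞ a (Ioi t₀)
  a_pos : ∀ t, t₀ < t → 0 < a t
  /-- the time-independent slice metric -/
  σ : Bundle.ContMDiffRiemannianMetric (𝓡 n) ∞ (EuclideanSpace ℝ (Fin n))
    (fun x : M ↦ TangentSpace (𝓡 n) x)
  /-- the curvature of the slice metric -/
  k : ℝ
  constant_curvature : HasConstantCurvature (I := 𝓡 n) (fun x u v ↦ σ.inner x u v) k

namespace Universe

variable {n : ℕ} {M : Type*} [TopologicalSpace M]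
  [ChartedSpace (EuclideanSpace ℝ (Fin n)) M] [IsManifold (𝓡 n) ∞ M]

/-- A Friedmann universe as a sliced space: `N = 1`, `β = 0`, `g_t = a(t)² σ`. -/
def slice (U : Universe n M) : SliceData (𝓡 n) M U.t₀ where
  lapse _ := 1
  shift _ := 0
  spatial p u v := U.a (p.2 : ℝ) ^ 2 * U.σ.inner p.1 u v

/-- The spacetime metric of a Friedmann universe. -/
def metric (U : Universe n M) : FormField ((𝓡 n).prod 𝓘(ℝ, ℝ)) (M × timeAxis U.t₀) :=
  U.slice.metric

/-- The metric of a Friedmann universe is `-dt² + a(t)² dσ²`. -/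
theorem metric_eq (U : Universe n M) (p : M × timeAxis U.t₀)
    (X Y : TangentSpace ((𝓡 n).prod 𝓘(ℝ, ℝ)) p) :
    U.metric p X Y = -(dt (𝓡 n) M U.t₀ p X * dt (𝓡 n) M U.t₀ p Y)
      + U.a (p.2 : ℝ) ^ 2 * U.σ.inner p.1 (dx p X) (dx p Y) := by
  simp [metric, slice, SliceData.metric]

/-- The time orientation by increasing `t`. -/
def timeForm (U : Universe n M) : OneForm ((𝓡 n).prod 𝓘(ℝ, ℝ)) (M × timeAxis U.t₀) :=
  dt (𝓡 n) M U.t₀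

/-- The Hubble expansion rate. -/
def hubble (U : Universe n M) (t : ℝ) : ℝ := deriv U.a t / U.a t

end Universe

end Friedmann

end

/-!
The theorem reduces to two facts about the factors of `M × (t₀, ∞)`.

*The slice metric `σ` is geodesically complete.* Let `c` be a `σ`-geodesic on a bounded interval of
parameters `[0, L)`, and not constant. It has constant speed, and by regular hyperbolicity the scale
factor is bounded, so a causal curve can follow `c` up to `c s` and then come back to `c 0`, in a
time that does not depend on `s < L`. Hence all `c s` lie in the projection to `M` of one causal
diamond, which is compact by global hyperbolicity (`exists_slice_geodesic`). A geodesic that stays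
in a compact set extends: by constancy of the speed its velocities stay in a compact set too, over
which the geodesic equation has solutions on a common interval (`exists_geodesic_of_isCompact`,
`exists_geodesic_Ioi`).

*Geodesics of the warped product are reparametrised slice geodesics.* The curve
`s ↦ (c (f s), τ s)` is a geodesic if `c` is one and `f`, `τ` solve two scalar equations
(`isGeodesicAt_metric`). These have the first integrals `a(τ)² f' = const` and
`τ'² - a(τ)² σ((c ∘ f)', (c ∘ f)') = const`, so `τ` satisfies a first-order autonomous equation
whose right-hand side is positive for future-directed causal initial velocities, and bounded because
`a` is bounded away from zero (or `c` is constant); such an equation can be solved for all positive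
parameters (`exists_autonomous_solution`).

Geodesics are handled in charts: `IsGeodesicAt` is the geodesic equation at one parameter, and
`geodesic_expression_comp` makes it independent of the chart, so that the usual theory of ordinary
differential equations on `E × E` applies to `geodesicField`.
-/

noncomputable section

namespace Friedmann

open Bundle
open scoped Topology

/-! ### Metric coefficients in a chart -/

section ChartMetric

variable {E : Type*} [NormedAddCommGroup E] [NormedSpace ℝ E]
  {M : Type*} [TopologicalSpace M] [ChartedSpace E M] [IsManifold 𝓘(ℝ, E) ∞ M]

theorem mdifferentiableAt_chart_symm {p : M} {y : E} (hy : y ∈ (extChartAt 𝓘(ℝ, E) p).target) :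
    MDifferentiableAt 𝓘(ℝ, E) 𝓘(ℝ, E) (extChartAt 𝓘(ℝ, E) p).symm y := by
  have : IsManifold 𝓘(ℝ, E) 1 M := .of_le (n := ∞) (by simp)
  rw [← mdifferentiableWithinAt_univ]
  simpa only [modelWithCornersSelf_coe, range_id] using
    mdifferentiableWithinAt_extChartAt_symm (I := 𝓘(ℝ, E)) hy

theorem mdifferentiableAt_chart {p x : M} (hx : x ∈ (extChartAt 𝓘(ℝ, E) p).source) :
    MDifferentiableAt 𝓘(ℝ, E) 𝓘(ℝ, E) (extChartAt 𝓘(ℝ, E) p) x := by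
  have : IsManifold 𝓘(ℝ, E) 1 M := .of_le (n := ∞) (by simp)
  exact mdifferentiableAt_extChartAt (by simpa using hx)

theorem mfderiv_chart_symm_mfderiv_chart {p x : M} (hx : x ∈ (extChartAt 𝓘(ℝ, E) p).source)
    (v : TangentSpace 𝓘(ℝ, E) x) :
    mfderiv 𝓘(ℝ, E) 𝓘(ℝ, E) (extChartAt 𝓘(ℝ, E) p).symm (extChartAt 𝓘(ℝ, E) p x)
      (mfderiv 𝓘(ℝ, E) 𝓘(ℝ, E) (extChartAt 𝓘(ℝ, E) p) x v) = v := by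
  have : IsManifold 𝓘(ℝ, E) 1 M := .of_le (n := ∞) (by simp)
  have h := mfderivWithin_extChartAt_symm_comp_mfderiv_extChartAt' (I := 𝓘(ℝ, E)) hx
  have := congrArg (fun f => f v) h
  simp only [modelWithCornersSelf_coe, range_id, mfderivWithin_univ] at this
  exact this

theorem mfderiv_chart_mfderiv_chart_symm {p : M} {y : E}
    (hy : y ∈ (extChartAt 𝓘(ℝ, E) p).target) (v : E) :
    mfderiv 𝓘(ℝ, E) 𝓘(ℝ, E) (extChartAt 𝓘(ℝ, E) p) ((extChartAt 𝓘(ℝ, E) p).symm y)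
      (mfderiv 𝓘(ℝ, E) 𝓘(ℝ, E) (extChartAt 𝓘(ℝ, E) p).symm y v) = v := by
  have : IsManifold 𝓘(ℝ, E) 1 M := .of_le (n := ∞) (by simp)
  have h := mfderiv_extChartAt_comp_mfderivWithin_extChartAt_symm (I := 𝓘(ℝ, E)) hy
  have := congrArg (fun f => f v) h
  simp only [modelWithCornersSelf_coe, range_id, mfderivWithin_univ] at this
  exact this

/-- The coefficients of a Riemannian metric in the chart at `p`, as a function with values in the
continuous bilinear forms. -/
def chartMetric (σ : ContMDiffRiemannianMetric 𝓘(ℝ, E) ∞ E (fun x : M ↦ TangentSpace 𝓘(ℝ, E) x))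
    (p : M) (y : E) : E →L[ℝ] E →L[ℝ] ℝ :=
  let D : E →L[ℝ] E := mfderiv 𝓘(ℝ, E) 𝓘(ℝ, E) (extChartAt 𝓘(ℝ, E) p).symm y
  let B : E →L[ℝ] E →L[ℝ] ℝ := σ.inner ((extChartAt 𝓘(ℝ, E) p).symm y)
  B.bilinearComp D D

variable (σ : ContMDiffRiemannianMetric 𝓘(ℝ, E) ∞ E (fun x : M ↦ TangentSpace 𝓘(ℝ, E) x)) (p : M)

theorem inChart_eq_chartMetric (y u v : E) :
    inChart (I := 𝓘(ℝ, E)) (fun x u v ↦ σ.inner x u v) p y u v = chartMetric σ p y u v :=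
  by unfold inChart chartMetric; exact Eq.refl _

theorem chartMetric_symm (y u v : E) : chartMetric σ p y u v = chartMetric σ p y v u := by
  rw [← inChart_eq_chartMetric, ← inChart_eq_chartMetric]
  exact σ.symm _ _ _

theorem chartMetric_pos {y : E} (hy : y ∈ (extChartAt 𝓘(ℝ, E) p).target) {u : E} (hu : u ≠ 0) :
    0 < chartMetric σ p y u u := by
  rw [← inChart_eq_chartMetric]
  refine σ.pos _ _ fun h ↦ hu ?_
  have := mfderiv_chart_mfderiv_chart_symm hy u
  erw [h] at this
  rw [← this]
  exact map_zero _

/-- The squared length of a tangent vector, read in a chart. -/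
theorem chartMetric_mfderiv {x : M} (hx : x ∈ (extChartAt 𝓘(ℝ, E) p).source)
    (u v : TangentSpace 𝓘(ℝ, E) x) :
    chartMetric σ p (extChartAt 𝓘(ℝ, E) p x)
      (mfderiv 𝓘(ℝ, E) 𝓘(ℝ, E) (extChartAt 𝓘(ℝ, E) p) x u)
      (mfderiv 𝓘(ℝ, E) 𝓘(ℝ, E) (extChartAt 𝓘(ℝ, E) p) x v) = σ.inner x u v := by
  have hu := mfderiv_chart_symm_mfderiv_chart hx u
  have hv := mfderiv_chart_symm_mfderiv_chart hx v
  have hx' : (extChartAt 𝓘(ℝ, E) p).symm (extChartAt 𝓘(ℝ, E) p x) = x :=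
    (extChartAt 𝓘(ℝ, E) p).left_inv hx
  refine (inChart_eq_chartMetric σ p _ _ _).symm.trans ?_
  change σ.inner ((extChartAt 𝓘(ℝ, E) p).symm (extChartAt 𝓘(ℝ, E) p x))
    (mfderiv 𝓘(ℝ, E) 𝓘(ℝ, E) (extChartAt 𝓘(ℝ, E) p).symm (extChartAt 𝓘(ℝ, E) p x)
      (mfderiv 𝓘(ℝ, E) 𝓘(ℝ, E) (extChartAt 𝓘(ℝ, E) p) x u))
    (mfderiv 𝓘(ℝ, E) 𝓘(ℝ, E) (extChartAt 𝓘(ℝ, E) p).symm (extChartAt 𝓘(ℝ, E) p x)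
      (mfderiv 𝓘(ℝ, E) 𝓘(ℝ, E) (extChartAt 𝓘(ℝ, E) p) x v)) = _
  erw [hu, hv]
  exact congrArg (fun z : M ↦ (show E →L[ℝ] E →L[ℝ] ℝ from σ.inner z) u v) hx'

theorem contDiffOn_chartMetric_apply (u v : E) :
    ContDiffOn ℝ ∞ (fun y ↦ chartMetric σ p y u v) (extChartAt 𝓘(ℝ, E) p).target := by
  have : IsManifold 𝓘(ℝ, E) 1 M := .of_le (n := ∞) (by simp)
  set e := trivializationAt E (TangentSpace 𝓘(ℝ, E) : M → Type _) p
  have he : e.baseSet = (extChartAt 𝓘(ℝ, E) p).source := by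
    rw [extChartAt_source]; exact TangentBundle.trivializationAt_baseSet p
  have hsec : ∀ u : E, ContMDiffOn 𝓘(ℝ, E) (𝓘(ℝ, E).prod 𝓘(ℝ, E)) ∞
      (fun m ↦ TotalSpace.mk' E (E := (TangentSpace 𝓘(ℝ, E) : M → Type _)) m (e.symmL ℝ m u))
      e.baseSet := by
    intro u x hx
    have h1 := (e.contMDiffAt_symmL (n := ∞) (IB := 𝓘(ℝ, E)) (𝕜 := ℝ) hx)
    have h2 : ContMDiffAt 𝓘(ℝ, E) (𝓘(ℝ, E).prod 𝓘(ℝ, E)) ∞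
      (fun m : M ↦ TotalSpace.mk' E (E := Bundle.Trivial M E) m u) x := by
      rw [contMDiffAt_totalSpace]
      exact ⟨contMDiffAt_id, contMDiffAt_const⟩
    exact (h1.clm_bundle_apply h2).contMDiffWithinAt
  have h3 : ContMDiffOn 𝓘(ℝ, E) 𝓘(ℝ, ℝ) ∞
      (fun m ↦ σ.inner m (e.symmL ℝ m u) (e.symmL ℝ m v)) e.baseSet := by
    intro x hx
    have := (σ.contMDiff.contMDiffOn (s := e.baseSet)).clm_bundle_apply₂ (hsec u) (hsec v) x hx
    simp only [contMDiffWithinAt_totalSpace] at this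
    exact this.2
  have h4 := (contMDiffOn_extChartAt_symm (I := 𝓘(ℝ, E)) (n := ∞) p)
  have h5 := h3.comp h4 (by
    intro y hy
    rw [mem_preimage, he]
    exact (extChartAt 𝓘(ℝ, E) p).map_target hy)
  refine (contMDiffOn_iff_contDiffOn.mp h5).congr fun y hy ↦ ?_
  have hx := (extChartAt 𝓘(ℝ, E) p).map_target hy
  have := TangentBundle.symmL_trivializationAt (I := 𝓘(ℝ, E)) (x₀ := p)
    (x := (extChartAt 𝓘(ℝ, E) p).symm y) (by simpa using hx)
  rw [(extChartAt 𝓘(ℝ, E) p).right_inv hy] at this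
  simp only [modelWithCornersSelf_coe, range_id, mfderivWithin_univ] at this
  simp only [Function.comp_apply]
  rw [this]
  rfl

theorem contDiffOn_chartMetric [FiniteDimensional ℝ E] :
    ContDiffOn ℝ ∞ (chartMetric σ p) (extChartAt 𝓘(ℝ, E) p).target := by
  rw [contDiffOn_clm_apply]
  intro u
  rw [contDiffOn_clm_apply]
  exact fun v ↦ contDiffOn_chartMetric_apply σ p u v

end ChartMetric

/-! ### The geodesic equation in coordinates -/

section GeodesicEquation

-- normed-space instances on iterated spaces of continuous linear maps need a deeper search
set_option maxSynthPendingDepth 3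

variable {E : Type*} [NormedAddCommGroup E] [NormedSpace ℝ E]

theorem fderiv_bilin_apply {B : E → E →L[ℝ] E →L[ℝ] ℝ} {y : E} (hB : DifferentiableAt ℝ B y)
    (u v h : E) : fderiv ℝ (fun z ↦ B z u v) y h = fderiv ℝ B y h u v := by
  have h1 : HasFDerivAt (fun z ↦ B z u v) _ y :=
    (hB.hasFDerivAt.clm_apply (hasFDerivAt_const u y)).clm_apply (hasFDerivAt_const v y)
  rw [h1.fderiv]
  simp

/-- The left-hand side `B(x'', w) + [x'x', w]` of the geodesic equation, tested against `w`, is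
invariant under a change of coordinates `φ`. -/
theorem geodesic_expression_comp {B₁ B₂ : E → E →L[ℝ] E →L[ℝ] ℝ} {φ : E → E} {x : ℝ → E} {r : ℝ}
    (hφ : ContDiffAt ℝ 2 φ (x r)) (hx : ContDiffAt ℝ 2 x r)
    (hB : DifferentiableAt ℝ B₂ (φ (x r))) (hsymm : ∀ u v, B₂ (φ (x r)) u v = B₂ (φ (x r)) v u)
    (h12 : ∀ᶠ z in 𝓝 (x r), ∀ u v, B₁ z u v = B₂ (φ z) (fderiv ℝ φ z u) (fderiv ℝ φ z v))
    (w : E) :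
    B₁ (x r) (deriv (deriv x) r) w
        + christoffel₁ (fun y u v ↦ B₁ y u v) (x r) (deriv x r) (deriv x r) w
      = B₂ (φ (x r)) (deriv (deriv (fun t ↦ φ (x t))) r) (fderiv ℝ φ (x r) w)
        + christoffel₁ (fun y u v ↦ B₂ y u v) (φ (x r)) (deriv (fun t ↦ φ (x t)) r)
          (deriv (fun t ↦ φ (x t)) r) (fderiv ℝ φ (x r) w) := by
  have hφd : HasFDerivAt φ (fderiv ℝ φ (x r)) (x r) :=
    (hφ.differentiableAt (by norm_num)).hasFDerivAt
  have hφ2 : DifferentiableAt ℝ (fderiv ℝ φ) (x r) :=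
    (hφ.fderiv_right (m := 1) (by norm_num)).differentiableAt (by norm_num)
  have hxd : DifferentiableAt ℝ x r := hx.differentiableAt (by norm_num)
  have hx2 : HasDerivAt (deriv x) (deriv (deriv x) r) r := by
    have := (hx.fderiv_right (m := 1) (by norm_num)).differentiableAt (by norm_num)
    refine DifferentiableAt.hasDerivAt ?_
    exact this.clm_apply (differentiableAt_const (1 : ℝ))
  set y := x r
  have hD : ∀ u v h : E, fderiv ℝ (fun z ↦ B₁ z u v) y h
      = fderiv ℝ B₂ (φ y) (fderiv ℝ φ y h) (fderiv ℝ φ y u) (fderiv ℝ φ y v)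
        + B₂ (φ y) (fderiv ℝ (fderiv ℝ φ) y h u) (fderiv ℝ φ y v)
        + B₂ (φ y) (fderiv ℝ φ y u) (fderiv ℝ (fderiv ℝ φ) y h v) := by
    intro u v h
    have e : (fun z ↦ B₁ z u v) =ᶠ[𝓝 y]
        fun z ↦ B₂ (φ z) (fderiv ℝ φ z u) (fderiv ℝ φ z v) := by
      filter_upwards [h12] with z hz using hz u v
    have hu := hφ2.hasFDerivAt.clm_apply (hasFDerivAt_const u y)
    have hv := hφ2.hasFDerivAt.clm_apply (hasFDerivAt_const v y)
    have hc : HasFDerivAt (fun z ↦ B₂ (φ z)) _ y :=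
      hB.hasFDerivAt.comp y hφd
    have h3 := (hc.clm_apply hu).clm_apply hv
    rw [e.fderiv_eq]
    rw [h3.fderiv]
    simp
    ring
  have hderiv : deriv (fun t ↦ φ (x t)) =ᶠ[𝓝 r] fun t ↦ fderiv ℝ φ (x t) (deriv x t) := by
    have h1 : ∀ᶠ t in 𝓝 r, DifferentiableAt ℝ x t := by
      filter_upwards [hx.eventually (by norm_num)] with t ht
      exact ht.differentiableAt (by norm_num)
    have h2 : ∀ᶠ t in 𝓝 r, DifferentiableAt ℝ φ (x t) := by
      have : ∀ᶠ z in 𝓝 y, DifferentiableAt ℝ φ z := by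
        filter_upwards [hφ.eventually (by norm_num)] with z hz
        exact hz.differentiableAt (by norm_num)
      exact hx.continuousAt.eventually this
    filter_upwards [h1, h2] with t ht1 ht2
    exact (ht2.hasFDerivAt.comp_hasDerivAt t ht1.hasDerivAt).deriv
  have hderiv2 : deriv (deriv (fun t ↦ φ (x t))) r
      = fderiv ℝ (fderiv ℝ φ) y (deriv x r) (deriv x r) + fderiv ℝ φ y (deriv (deriv x) r) := by
    rw [hderiv.deriv_eq]
    have := (hφ2.hasFDerivAt.comp_hasDerivAt r hxd.hasDerivAt).clm_apply hx2
    exact this.deriv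
  have hsymm2 : ∀ u v, fderiv ℝ (fderiv ℝ φ) y u v = fderiv ℝ (fderiv ℝ φ) y v u := fun u v ↦
    (hφ.isSymmSndFDerivAt (by simp)).eq u v
  rw [hderiv2, hderiv.eq_of_nhds]
  simp only [christoffel₁, hD, fderiv_bilin_apply hB]
  rw [h12.self_of_nhds]
  simp only [map_add, add_apply]
  rw [hsymm2 w (deriv x r), hsymm (fderiv ℝ (fderiv ℝ φ) y (deriv x r) w)]
  change _ + _ = _ + _
  ring

/-- The one-form `w ↦ [uu, w]` of Christoffel symbols of the first kind. -/
def christoffelForm (B : E → E →L[ℝ] E →L[ℝ] ℝ) (y u : E) : E →L[ℝ] ℝ :=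
  fderiv ℝ B y u u - (1 / 2 : ℝ) • ((fderiv ℝ B y).flip u).flip u

theorem christoffelForm_apply {B : E → E →L[ℝ] E →L[ℝ] ℝ} {y : E} (hB : DifferentiableAt ℝ B y)
    (u w : E) : christoffelForm B y u w = christoffel₁ (fun y u v ↦ B y u v) y u u w := by
  simp only [christoffelForm, christoffel₁, fderiv_bilin_apply hB]
  simp
  ring

/-- The vector field on `E × E` whose integral curves are the pairs `(x, x')` with `x` a geodesic
of the metric `B` given in coordinates. -/
def geodesicField (B : E → E →L[ℝ] E →L[ℝ] ℝ) (z : E × E) : E × E :=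
  (z.2, -(B z.1).inverse (christoffelForm B z.1 z.2))

theorem isInvertible_of_pos [FiniteDimensional ℝ E] {b : E →L[ℝ] E →L[ℝ] ℝ}
    (hb : ∀ u, u ≠ 0 → 0 < b u u) : b.IsInvertible := by
  have hinj : Function.Injective b := by
    refine (injective_iff_map_eq_zero b).2 fun u hu ↦ ?_
    by_contra h
    have := hb u h
    simp [hu] at this
  have hrank : Module.finrank ℝ E = Module.finrank ℝ (E →L[ℝ] ℝ) := by
    rw [← (LinearMap.toContinuousLinearMap (𝕜 := ℝ) (E := E) (F' := ℝ)).finrank_eq]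
    exact (Subspace.dual_finrank_eq (K := ℝ) (V := E)).symm
  let e := (LinearEquiv.ofInjectiveOfFinrankEq (b : E →ₗ[ℝ] E →L[ℝ] ℝ) hinj
    hrank).toContinuousLinearEquiv
  exact ⟨e, by ext u v; rfl⟩

theorem geodesicField_snd_eq_iff {B : E → E →L[ℝ] E →L[ℝ] ℝ} {y : E} (hB : DifferentiableAt ℝ B y)
    (hinv : (B y).IsInvertible) (a u : E) :
    (∀ w, B y a w + christoffel₁ (fun y u v ↦ B y u v) y u u w = 0) ↔
      a = (geodesicField B (y, u)).2 := by
  simp only [← christoffelForm_apply hB]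
  obtain ⟨e, he⟩ := hinv
  simp only [geodesicField, ← he, ContinuousLinearMap.inverse_equiv]
  rw [← map_neg]
  constructor
  · intro h
    have : e a = - christoffelForm B y u := by
      ext w
      have := h w
      simp only [neg_apply]
      change e a w = _
      change e a w + _ = 0 at this
      linarith
    rw [← this]
    simp
  · rintro rfl w
    simp

theorem contDiffOn_geodesicField [FiniteDimensional ℝ E] {B : E → E →L[ℝ] E →L[ℝ] ℝ} {O : Set E}
    (hO : IsOpen O) (hB : ContDiffOn ℝ ∞ B O) (hpos : ∀ y ∈ O, ∀ u, u ≠ 0 → 0 < B y u u) :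
    ContDiffOn ℝ 1 (geodesicField B) (O ×ˢ univ) := by
  have : CompleteSpace E := FiniteDimensional.complete ℝ E
  have hmaps : MapsTo Prod.fst (O ×ˢ (univ : Set E)) O := fun z hz ↦ hz.1
  have hdB : ContDiffOn ℝ 1 (fun z : E × E ↦ fderiv ℝ B z.1) (O ×ˢ univ) :=
    (hB.fderiv_of_isOpen hO (m := 1) (by norm_num; exact ENat.LEInfty.out)).comp contDiffOn_fst
      hmaps
  have hform : ContDiffOn ℝ 1 (fun z : E × E ↦ christoffelForm B z.1 z.2) (O ×ˢ univ) := by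
    rw [contDiffOn_clm_apply]
    intro w
    have h1 : ContDiffOn ℝ 1 (fun z : E × E ↦ fderiv ℝ B z.1 z.2 z.2 w) (O ×ˢ univ) :=
      ((hdB.clm_apply contDiffOn_snd).clm_apply contDiffOn_snd).clm_apply contDiffOn_const
    have h2 : ContDiffOn ℝ 1 (fun z : E × E ↦ fderiv ℝ B z.1 w z.2 z.2) (O ×ˢ univ) :=
      ((hdB.clm_apply contDiffOn_const).clm_apply contDiffOn_snd).clm_apply contDiffOn_snd
    refine (h1.sub (h2.const_smul (1 / 2 : ℝ))).congr fun z _ ↦ ?_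
    simp [christoffelForm]
  have hinv : ContDiffOn ℝ 1 (fun z : E × E ↦ (B z.1).inverse) (O ×ˢ univ) := by
    intro z hz
    obtain ⟨e, he⟩ := isInvertible_of_pos (hpos z.1 hz.1)
    have h1 : ContDiffAt ℝ 1 ContinuousLinearMap.inverse (B z.1) := he ▸ contDiffAt_map_inverse e
    have h2 : ContDiffAt ℝ 1 (fun z : E × E ↦ B z.1) z :=
      ((hB.contDiffAt (hO.mem_nhds hz.1)).of_le (by exact_mod_cast le_top)).comp z contDiffAt_fst
    exact (h1.comp z h2).contDiffWithinAt
  exact contDiffOn_snd.prodMk (hinv.clm_apply hform).neg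

/-- **Local flow.** A `C¹` vector field on an open set `O` has, near each point of `O`, integral
curves that stay in `O` on a common interval of time. -/
theorem exists_integralCurve_mem {F : Type*} [NormedAddCommGroup F] [NormedSpace ℝ F]
    [CompleteSpace F] {f : F → F} {O : Set F} (hO : IsOpen O) (hf : ContDiffOn ℝ 1 f O) {z₀ : F}
    (hz₀ : z₀ ∈ O) :
    ∃ δ > (0 : ℝ), ∀ᶠ z in 𝓝 z₀, ∃ α : ℝ → F, α 0 = z ∧
      ∀ t ∈ Ioo (-δ) δ, HasDerivAt α (f (α t)) t ∧ α t ∈ O := by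
  obtain ⟨ε, hε, a, r, L, K, hr, H⟩ :=
    IsPicardLindelof.of_contDiffAt_one (hf.contDiffAt (hO.mem_nhds hz₀))
  obtain ⟨α, hα, hcont⟩ := (H 0).exists_forall_mem_closedBall_eq_hasDerivWithinAt_continuousOn
  have hz₀r : z₀ ∈ Metric.closedBall z₀ (r : ℝ) := Metric.mem_closedBall_self r.2
  have hnhds : Metric.closedBall z₀ (r : ℝ) ×ˢ Icc (0 - ε) (0 + ε) ∈ 𝓝 (z₀, (0 : ℝ)) :=
    prod_mem_nhds (Metric.closedBall_mem_nhds _ (by exact_mod_cast hr))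
      (Icc_mem_nhds (by linarith) (by linarith))
  have hα0 : α (z₀, 0) = z₀ := (hα z₀ hz₀r).1
  have hO' : ∀ᶠ q in 𝓝 z₀ ×ˢ 𝓝 (0 : ℝ), α q ∈ O := by
    rw [← nhds_prod_eq]
    exact (hcont.continuousAt hnhds).eventually (hO.mem_nhds (by rwa [hα0]))
  obtain ⟨P, hP, Q, hQ, hPQ⟩ := Filter.eventually_prod_iff.1 hO'
  obtain ⟨δ, hδ, hball⟩ := Metric.eventually_nhds_iff_ball.1 hQ
  refine ⟨min δ ε, lt_min hδ hε, ?_⟩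
  filter_upwards [hP, Metric.closedBall_mem_nhds z₀ (by exact_mod_cast hr : (0 : ℝ) < r)]
    with z hzP hzr
  refine ⟨fun t ↦ α (z, t), (hα z hzr).1, fun t ht ↦ ⟨?_, ?_⟩⟩
  · have h1 : -ε < t := by linarith [ht.1, min_le_right δ ε]
    have h2 : t < ε := lt_of_lt_of_le ht.2 (min_le_right δ ε)
    exact ((hα z hzr).2 t ⟨by linarith, by linarith⟩).hasDerivAt
      (Icc_mem_nhds (by linarith) (by linarith))
  · refine hPQ hzP (hball t ?_)
    rw [Real.ball_eq_Ioo]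
    exact ⟨by linarith [ht.1, min_le_left δ ε], by linarith [ht.2, min_le_left δ ε]⟩

end GeodesicEquation

/-! ### Geodesics of a Riemannian manifold: local theory -/

section PointwiseGeodesics

variable {E : Type*} [NormedAddCommGroup E] [NormedSpace ℝ E]
  {H : Type*} [TopologicalSpace H] {I : ModelWithCorners ℝ E H}
  {V : Type*} [TopologicalSpace V] [ChartedSpace H V]

/-- The geodesic equation for `γ` at the single parameter `r`; it depends on the germ of `γ` at `r`
only. -/
def IsGeodesicAt (g : FormField I V) (γ : ℝ → V) (r : ℝ) : Prop :=
  ContMDiffAt 𝓘(ℝ, ℝ) I 2 γ r ∧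
  ∀ p₀ : V, γ r ∈ (extChartAt I p₀).source → ∀ w : E,
    inChart g p₀ (extChartAt I p₀ (γ r)) (deriv (deriv (fun x ↦ extChartAt I p₀ (γ x))) r) w
      + christoffel₁ (inChart g p₀) (extChartAt I p₀ (γ r))
          (deriv (fun x ↦ extChartAt I p₀ (γ x)) r)
          (deriv (fun x ↦ extChartAt I p₀ (γ x)) r) w = 0

theorem isGeodesicOn_of_forall_isGeodesicAt {g : FormField I V} {γ : ℝ → V} {s : Set ℝ}
    (h : ∀ r ∈ s, IsGeodesicAt g γ r) : IsGeodesicOn g γ s :=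
  ⟨fun r hr ↦ (h r hr).1.contMDiffWithinAt, fun p₀ r hr ↦ (h r hr).2 p₀⟩

theorem IsGeodesicAt.congr {g : FormField I V} {γ γ' : ℝ → V} {r : ℝ} (h : IsGeodesicAt g γ r)
    (hγ : γ' =ᶠ[𝓝 r] γ) : IsGeodesicAt g γ' r := by
  refine ⟨h.1.congr_of_eventuallyEq hγ, fun p₀ hr w ↦ ?_⟩
  have e : (fun x ↦ extChartAt I p₀ (γ' x)) =ᶠ[𝓝 r] fun x ↦ extChartAt I p₀ (γ x) := by
    filter_upwards [hγ] with x hx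
    rw [hx]
  rw [hγ.eq_of_nhds] at hr
  rw [e.deriv.deriv_eq, e.deriv_eq, hγ.eq_of_nhds]
  exact h.2 p₀ hr w

theorem IsGeodesicAt.comp_add_const {g : FormField I V} {γ : ℝ → V} {r a : ℝ}
    (h : IsGeodesicAt g γ (r + a)) : IsGeodesicAt g (fun x ↦ γ (x + a)) r := by
  refine ⟨?_, fun p₀ hr w ↦ ?_⟩
  · have h1 : ContMDiffAt 𝓘(ℝ, ℝ) 𝓘(ℝ, ℝ) 2 (fun x : ℝ ↦ x + a) r :=
      (contDiffAt_id.add contDiffAt_const).contMDiffAt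
    exact ContMDiffAt.comp r h.1 h1
  · have e1 : deriv (fun x ↦ extChartAt I p₀ (γ (x + a)))
        = fun x ↦ deriv (fun x ↦ extChartAt I p₀ (γ x)) (x + a) := by
      funext x
      exact deriv_comp_add_const (f := fun x ↦ extChartAt I p₀ (γ x)) a x
    rw [e1, deriv_comp_add_const]
    exact h.2 p₀ hr w

theorem velocity_congr {γ γ' : ℝ → V} {r : ℝ} (h : γ' =ᶠ[𝓝 r] γ) :
    velocity I γ' r = velocity I γ r := by
  unfold velocity
  refine TotalSpace.ext h.eq_of_nhds ?_
  rw [h.mfderiv_eq]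
  exact HEq.rfl

theorem velocity_comp {γ : ℝ → V} {f : ℝ → ℝ} {f' r : ℝ} (h : MDifferentiableAt 𝓘(ℝ, ℝ) I γ (f r))
    (hf : HasDerivAt f f' r) :
    velocity I (fun x ↦ γ (f x)) r
      = ⟨γ (f r), f' • (mfderiv 𝓘(ℝ, ℝ) I γ (f r) (1 : ℝ) : TangentSpace I (γ (f r)))⟩ := by
  have h2 := (HasMFDerivAt.comp r h.hasMFDerivAt hf.hasFDerivAt.hasMFDerivAt).mfderiv
  unfold velocity
  change (⟨γ (f r), _⟩ : TangentBundle I V) = _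
  congr 1
  change mfderiv 𝓘(ℝ, ℝ) I (γ ∘ f) r (1 : ℝ) = _
  rw [h2]
  change mfderiv 𝓘(ℝ, ℝ) I γ (f r) ((1 : ℝ) • f') = _
  have h3 := (show ℝ →L[ℝ] E from mfderiv 𝓘(ℝ, ℝ) I γ (f r)).map_smul f' 1
  rw [smul_eq_mul, mul_one] at h3
  rw [one_smul]
  exact h3

theorem velocity_comp_add_const {γ : ℝ → V} {r a : ℝ} (h : MDifferentiableAt 𝓘(ℝ, ℝ) I γ (r + a)) :
    velocity I (fun x ↦ γ (x + a)) r = velocity I γ (r + a) := by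
  rw [velocity_comp (f := fun x ↦ x + a) h ((hasDerivAt_id r).add_const a), one_smul]
  rfl

end PointwiseGeodesics

section RiemannianGeodesics

variable {E : Type*} [NormedAddCommGroup E] [NormedSpace ℝ E]
  {M : Type*} [TopologicalSpace M] [ChartedSpace E M]

/-- The coordinates of a tangent vector, base point first, in the chart at `p`. -/
def chartState (p : M) (X : TangentBundle 𝓘(ℝ, E) M) : E × E :=
  (extChartAt 𝓘(ℝ, E) p X.1, mfderiv 𝓘(ℝ, E) 𝓘(ℝ, E) (extChartAt 𝓘(ℝ, E) p) X.1 X.2)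

theorem eventually_mem_chart_source {p : M} {c : ℝ → M} {r : ℝ} (hc : ContinuousAt c r)
    (hr : c r ∈ (extChartAt 𝓘(ℝ, E) p).source) :
    ∀ᶠ t in 𝓝 r, c t ∈ (extChartAt 𝓘(ℝ, E) p).source :=
  hc.eventually ((isOpen_extChartAt_source p).mem_nhds hr)

variable [IsManifold 𝓘(ℝ, E) ∞ M]

theorem chartState_injOn {p : M} {X Y : TangentBundle 𝓘(ℝ, E) M}
    (hX : X.1 ∈ (extChartAt 𝓘(ℝ, E) p).source) (hY : Y.1 ∈ (extChartAt 𝓘(ℝ, E) p).source)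
    (h : chartState p X = chartState p Y) : X = Y := by
  obtain ⟨x, u⟩ := X
  obtain ⟨y, v⟩ := Y
  have h1 : x = y := (extChartAt 𝓘(ℝ, E) p).injOn hX hY (congrArg Prod.fst h)
  subst h1
  congr 1
  have h2 : mfderiv 𝓘(ℝ, E) 𝓘(ℝ, E) (extChartAt 𝓘(ℝ, E) p) x u
    = mfderiv 𝓘(ℝ, E) 𝓘(ℝ, E) (extChartAt 𝓘(ℝ, E) p) x v := congrArg Prod.snd h
  rw [← mfderiv_chart_symm_mfderiv_chart hX u, h2, mfderiv_chart_symm_mfderiv_chart hX v]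

theorem chartState_velocity {p : M} {c : ℝ → M} {r : ℝ}
    (hc : MDifferentiableAt 𝓘(ℝ, ℝ) 𝓘(ℝ, E) c r) (hr : c r ∈ (extChartAt 𝓘(ℝ, E) p).source) :
    chartState p (velocity 𝓘(ℝ, E) c r)
      = (extChartAt 𝓘(ℝ, E) p (c r), deriv (fun t ↦ extChartAt 𝓘(ℝ, E) p (c t)) r) := by
  refine Prod.ext rfl ?_
  have h := mfderiv_comp r (mdifferentiableAt_chart hr) hc
  rw [mfderiv_eq_fderiv] at h
  change mfderiv 𝓘(ℝ, E) 𝓘(ℝ, E) (extChartAt 𝓘(ℝ, E) p) (c r)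
    (mfderiv 𝓘(ℝ, ℝ) 𝓘(ℝ, E) c r (1 : ℝ)) = _
  change _ = fderiv ℝ ((extChartAt 𝓘(ℝ, E) p) ∘ c) r 1
  rw [h]
  rfl

/-- A Riemannian metric, as a field of forms. -/
abbrev formField (σ : ContMDiffRiemannianMetric 𝓘(ℝ, E) ∞ E
    (fun x : M ↦ TangentSpace 𝓘(ℝ, E) x)) : FormField 𝓘(ℝ, E) M :=
  fun x u v ↦ σ.inner x u v

variable (σ : ContMDiffRiemannianMetric 𝓘(ℝ, E) ∞ E (fun x : M ↦ TangentSpace 𝓘(ℝ, E) x))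

theorem contDiffAt_chart_comp {p : M} {c : ℝ → M} {r : ℝ} {k : WithTop ℕ∞} (hk : k ≤ ∞)
    (hc : ContMDiffAt 𝓘(ℝ, ℝ) 𝓘(ℝ, E) k c r) (hr : c r ∈ (extChartAt 𝓘(ℝ, E) p).source) :
    ContDiffAt ℝ k (fun t ↦ extChartAt 𝓘(ℝ, E) p (c t)) r := by
  have h1 : ContMDiffAt 𝓘(ℝ, E) 𝓘(ℝ, E) ∞ (extChartAt 𝓘(ℝ, E) p) (c r) :=
    contMDiffAt_extChartAt' (by simpa using hr)
  exact (ContMDiffAt.comp r (h1.of_le hk) hc).contDiffAt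

/-- The change of coordinates of the metric coefficients. -/
theorem chartMetric_change (p q : M) {z : E} (hz : z ∈ (extChartAt 𝓘(ℝ, E) q).target)
    (hzp : (extChartAt 𝓘(ℝ, E) q).symm z ∈ (extChartAt 𝓘(ℝ, E) p).source) (u v : E) :
    chartMetric σ q z u v
      = chartMetric σ p (extChartAt 𝓘(ℝ, E) p ((extChartAt 𝓘(ℝ, E) q).symm z))
        (fderiv ℝ (fun y ↦ extChartAt 𝓘(ℝ, E) p ((extChartAt 𝓘(ℝ, E) q).symm y)) z u)
        (fderiv ℝ (fun y ↦ extChartAt 𝓘(ℝ, E) p ((extChartAt 𝓘(ℝ, E) q).symm y)) z v) := by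
  have h := mfderiv_comp z (mdifferentiableAt_chart hzp) (mdifferentiableAt_chart_symm hz)
  rw [mfderiv_eq_fderiv] at h
  change fderiv ℝ (fun y ↦ extChartAt 𝓘(ℝ, E) p ((extChartAt 𝓘(ℝ, E) q).symm y)) z = _ at h
  rw [h]
  exact (chartMetric_mfderiv σ p hzp _ _).symm

variable [FiniteDimensional ℝ E]

theorem differentiableAt_chartMetric {p : M} {y : E} (hy : y ∈ (extChartAt 𝓘(ℝ, E) p).target) :
    DifferentiableAt ℝ (chartMetric σ p) y :=
  ((contDiffOn_chartMetric σ p).contDiffAt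
    ((isOpen_extChartAt_target p).mem_nhds hy)).differentiableAt (by simp)

/-- The geodesic equation need only be checked in one chart. -/
theorem isGeodesicAt_of_chart {p : M} {c : ℝ → M} {r : ℝ}
    (hc : ContMDiffAt 𝓘(ℝ, ℝ) 𝓘(ℝ, E) 2 c r) (hr : c r ∈ (extChartAt 𝓘(ℝ, E) p).source)
    (h : ∀ w, chartMetric σ p (extChartAt 𝓘(ℝ, E) p (c r))
          (deriv (deriv (fun t ↦ extChartAt 𝓘(ℝ, E) p (c t))) r) w
        + christoffel₁ (fun y u v ↦ chartMetric σ p y u v) (extChartAt 𝓘(ℝ, E) p (c r))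
          (deriv (fun t ↦ extChartAt 𝓘(ℝ, E) p (c t)) r)
          (deriv (fun t ↦ extChartAt 𝓘(ℝ, E) p (c t)) r) w = 0) :
    IsGeodesicAt (formField σ) c r := by
  refine ⟨hc, fun q hq w ↦ ?_⟩
  set φ : E → E := fun y ↦ extChartAt 𝓘(ℝ, E) p ((extChartAt 𝓘(ℝ, E) q).symm y)
  set x : ℝ → E := fun t ↦ extChartAt 𝓘(ℝ, E) q (c t)
  have hxr : x r ∈ (extChartAt 𝓘(ℝ, E) q).target := (extChartAt 𝓘(ℝ, E) q).map_source hq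
  have hback : (extChartAt 𝓘(ℝ, E) q).symm (x r) = c r := (extChartAt 𝓘(ℝ, E) q).left_inv hq
  have hφx : φ (x r) = extChartAt 𝓘(ℝ, E) p (c r) := congrArg (extChartAt 𝓘(ℝ, E) p) hback
  have hsymm : ContMDiffAt 𝓘(ℝ, E) 𝓘(ℝ, E) ∞ (extChartAt 𝓘(ℝ, E) q).symm (x r) :=
    (contMDiffOn_extChartAt_symm q).contMDiffAt ((isOpen_extChartAt_target q).mem_nhds hxr)
  have hφ : ContDiffAt ℝ 2 φ (x r) := by
    have h1 : ContMDiffAt 𝓘(ℝ, E) 𝓘(ℝ, E) ∞ (extChartAt 𝓘(ℝ, E) p)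
        ((extChartAt 𝓘(ℝ, E) q).symm (x r)) :=
      contMDiffAt_extChartAt' (by rw [hback]; simpa using hr)
    exact (ContMDiffAt.comp (x r) h1 hsymm).contDiffAt.of_le ENat.LEInfty.out
  have hev : ∀ᶠ z in 𝓝 (x r), ∀ u v, chartMetric σ q z u v
      = chartMetric σ p (φ z) (fderiv ℝ φ z u) (fderiv ℝ φ z v) := by
    have h1 : ∀ᶠ z in 𝓝 (x r), (extChartAt 𝓘(ℝ, E) q).symm z ∈ (extChartAt 𝓘(ℝ, E) p).source :=
      hsymm.continuousAt.eventually ((isOpen_extChartAt_source p).mem_nhds (by rwa [hback]))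
    filter_upwards [h1, (isOpen_extChartAt_target q).mem_nhds hxr] with z hz hz' u v
    exact chartMetric_change σ p q hz' hz u v
  have hx : ContDiffAt ℝ 2 x r := contDiffAt_chart_comp ENat.LEInfty.out hc hq
  have key := geodesic_expression_comp hφ hx
    (differentiableAt_chartMetric σ (by rw [hφx]; exact (extChartAt 𝓘(ℝ, E) p).map_source hr))
    (chartMetric_symm σ p _) hev w
  have e : (fun t ↦ φ (x t)) =ᶠ[𝓝 r] fun t ↦ extChartAt 𝓘(ℝ, E) p (c t) := by
    filter_upwards [eventually_mem_chart_source hc.continuousAt hq] with t ht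
    exact congrArg (extChartAt 𝓘(ℝ, E) p) ((extChartAt 𝓘(ℝ, E) q).left_inv ht)
  rw [e.deriv.deriv_eq, e.deriv_eq, hφx, h] at key
  exact key

variable {σ} in
theorem IsGeodesicAt.hasDerivAt_chart {p : M} {c : ℝ → M} {r : ℝ}
    (h : IsGeodesicAt (formField σ) c r) (hr : c r ∈ (extChartAt 𝓘(ℝ, E) p).source) :
    HasDerivAt (fun t ↦ (extChartAt 𝓘(ℝ, E) p (c t), deriv (fun t ↦ extChartAt 𝓘(ℝ, E) p (c t)) t))
      (geodesicField (chartMetric σ p)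
        (extChartAt 𝓘(ℝ, E) p (c r), deriv (fun t ↦ extChartAt 𝓘(ℝ, E) p (c t)) r)) r := by
  have hx := contDiffAt_chart_comp ENat.LEInfty.out h.1 hr
  set x : ℝ → E := fun t ↦ extChartAt 𝓘(ℝ, E) p (c t)
  have hx1 : HasDerivAt x (deriv x r) r := (hx.differentiableAt (by norm_num)).hasDerivAt
  have hx2 : HasDerivAt (deriv x) (deriv (deriv x) r) r := by
    have := (hx.fderiv_right (m := 1) (by norm_num)).differentiableAt (by norm_num)
    refine DifferentiableAt.hasDerivAt ?_
    exact this.clm_apply (differentiableAt_const (1 : ℝ))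
  have hxr : x r ∈ (extChartAt 𝓘(ℝ, E) p).target := (extChartAt 𝓘(ℝ, E) p).map_source hr
  have := (geodesicField_snd_eq_iff (differentiableAt_chartMetric σ hxr)
    (isInvertible_of_pos fun u hu ↦ chartMetric_pos σ p hxr hu) _ _).1 (h.2 p hr)
  rw [this] at hx2
  exact hx1.prodMk hx2

/-- Integral curves of the geodesic field in a chart are geodesics. -/
theorem isGeodesicAt_of_integralCurve {p : M} {α : ℝ → E × E} {S : Set ℝ} (hS : IsOpen S)
    (hα : ∀ t ∈ S, HasDerivAt α (geodesicField (chartMetric σ p) (α t)) t ∧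
      α t ∈ (extChartAt 𝓘(ℝ, E) p).target ×ˢ univ) {r : ℝ} (hr : r ∈ S) :
    IsGeodesicAt (formField σ) (fun t ↦ (extChartAt 𝓘(ℝ, E) p).symm (α t).1) r ∧
      chartState p (velocity 𝓘(ℝ, E) (fun t ↦ (extChartAt 𝓘(ℝ, E) p).symm (α t).1) r) = α r := by
  set c : ℝ → M := fun t ↦ (extChartAt 𝓘(ℝ, E) p).symm (α t).1
  have h1 : ∀ t ∈ S, HasDerivAt (fun t ↦ (α t).1) (α t).2 t := fun t ht ↦ (hα t ht).1.fst
  have h2 : ∀ t ∈ S, HasDerivAt (fun t ↦ (α t).2)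
    (geodesicField (chartMetric σ p) (α t)).2 t := fun t ht ↦ (hα t ht).1.snd
  have hαc : ContinuousOn α S := fun t ht ↦ (hα t ht).1.continuousAt.continuousWithinAt
  have hfield := contDiffOn_geodesicField (isOpen_extChartAt_target p) (contDiffOn_chartMetric σ p)
    fun y hy u hu ↦ chartMetric_pos σ p hy hu
  have hC1 : ContDiffOn ℝ 1 (fun t ↦ (α t).2) S := by
    rw [show (1 : WithTop ℕ∞) = 0 + 1 by norm_num, contDiffOn_succ_iff_deriv_of_isOpen hS]
    refine ⟨fun t ht ↦ (h2 t ht).differentiableAt.differentiableWithinAt, by simp, ?_⟩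
    rw [contDiffOn_zero]
    have := (hfield.continuousOn.comp hαc fun t ht ↦ (hα t ht).2).snd
    exact this.congr fun t ht ↦ (h2 t ht).deriv
  have hC2 : ContDiffOn ℝ 2 (fun t ↦ (α t).1) S := by
    rw [show (2 : WithTop ℕ∞) = 1 + 1 by norm_num, contDiffOn_succ_iff_deriv_of_isOpen hS]
    exact ⟨fun t ht ↦ (h1 t ht).differentiableAt.differentiableWithinAt, by simp,
      hC1.congr fun t ht ↦ (h1 t ht).deriv⟩
  have hmem : ∀ t ∈ S, (α t).1 ∈ (extChartAt 𝓘(ℝ, E) p).target := fun t ht ↦ (hα t ht).2.1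
  have hsrc : c r ∈ (extChartAt 𝓘(ℝ, E) p).source :=
    (extChartAt 𝓘(ℝ, E) p).map_target (hmem r hr)
  have hc : ContMDiffAt 𝓘(ℝ, ℝ) 𝓘(ℝ, E) 2 c r := by
    have hsymm : ContMDiffAt 𝓘(ℝ, E) 𝓘(ℝ, E) 2 (extChartAt 𝓘(ℝ, E) p).symm (α r).1 :=
      ((contMDiffOn_extChartAt_symm (n := ∞) p).contMDiffAt
        ((isOpen_extChartAt_target p).mem_nhds (hmem r hr))).of_le ENat.LEInfty.out
    exact ContMDiffAt.comp r hsymm (hC2.contDiffAt (hS.mem_nhds hr)).contMDiffAt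
  have hright : ∀ t ∈ S, extChartAt 𝓘(ℝ, E) p (c t) = (α t).1 := fun t ht ↦
    (extChartAt 𝓘(ℝ, E) p).right_inv (hmem t ht)
  have e : ∀ t ∈ S, (fun t ↦ extChartAt 𝓘(ℝ, E) p (c t)) =ᶠ[𝓝 t] fun t ↦ (α t).1 := fun t ht ↦ by
    filter_upwards [hS.mem_nhds ht] with s hs using hright s hs
  have hd : ∀ t ∈ S, deriv (fun t ↦ extChartAt 𝓘(ℝ, E) p (c t)) t = (α t).2 := fun t ht ↦ by
    rw [(e t ht).deriv_eq, (h1 t ht).deriv]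
  have hdd : deriv (deriv (fun t ↦ extChartAt 𝓘(ℝ, E) p (c t))) r
      = (geodesicField (chartMetric σ p) (α r)).2 := by
    have : deriv (fun t ↦ extChartAt 𝓘(ℝ, E) p (c t)) =ᶠ[𝓝 r] fun t ↦ (α t).2 := by
      filter_upwards [hS.mem_nhds hr] with s hs using hd s hs
    rw [this.deriv_eq, (h2 r hr).deriv]
  constructor
  · refine isGeodesicAt_of_chart σ hc hsrc ?_
    rw [hdd, hd r hr, hright r hr]
    exact (geodesicField_snd_eq_iff (differentiableAt_chartMetric σ (hmem r hr))
      (isInvertible_of_pos fun u hu ↦ chartMetric_pos σ p (hmem r hr) hu) _ _).2 rfl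
  · rw [chartState_velocity (hc.mdifferentiableAt (by norm_num)) hsrc, hd r hr, hright r hr]

variable {σ} in
/-- A geodesic is determined near a parameter by its velocity there. -/
theorem eventuallyEq_of_velocity_eq {c₁ c₂ : ℝ → M} {r : ℝ}
    (h₁ : ∀ᶠ t in 𝓝 r, IsGeodesicAt (formField σ) c₁ t)
    (h₂ : ∀ᶠ t in 𝓝 r, IsGeodesicAt (formField σ) c₂ t)
    (hv : velocity 𝓘(ℝ, E) c₁ r = velocity 𝓘(ℝ, E) c₂ r) : c₁ =ᶠ[𝓝 r] c₂ := by
  have hpt : c₁ r = c₂ r := congrArg TotalSpace.proj hv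
  set p := c₁ r
  have hs₁ : c₁ r ∈ (extChartAt 𝓘(ℝ, E) p).source := mem_extChartAt_source p
  have hs₂ : c₂ r ∈ (extChartAt 𝓘(ℝ, E) p).source := by rw [← hpt]; exact mem_extChartAt_source p
  set f := geodesicField (chartMetric σ p)
  have hO : IsOpen ((extChartAt 𝓘(ℝ, E) p).target ×ˢ (univ : Set E)) :=
    (isOpen_extChartAt_target p).prod isOpen_univ
  have hf : ContDiffOn ℝ 1 f ((extChartAt 𝓘(ℝ, E) p).target ×ˢ univ) :=
    contDiffOn_geodesicField (isOpen_extChartAt_target p) (contDiffOn_chartMetric σ p)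
      fun y hy u hu ↦ chartMetric_pos σ p hy hu
  set z₁ : ℝ → E × E := fun t ↦
    (extChartAt 𝓘(ℝ, E) p (c₁ t), deriv (fun t ↦ extChartAt 𝓘(ℝ, E) p (c₁ t)) t)
  set z₂ : ℝ → E × E := fun t ↦
    (extChartAt 𝓘(ℝ, E) p (c₂ t), deriv (fun t ↦ extChartAt 𝓘(ℝ, E) p (c₂ t)) t)
  have g₁ := h₁.self_of_nhds
  have g₂ := h₂.self_of_nhds
  have e₁ := chartState_velocity (g₁.1.mdifferentiableAt (by norm_num)) hs₁
  have e₂ := chartState_velocity (g₂.1.mdifferentiableAt (by norm_num)) hs₂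
  have hz : z₁ r = z₂ r := by rw [hv] at e₁; exact e₁.symm.trans e₂
  have hz₁O : z₁ r ∈ (extChartAt 𝓘(ℝ, E) p).target ×ˢ (univ : Set E) :=
    ⟨(extChartAt 𝓘(ℝ, E) p).map_source hs₁, mem_univ _⟩
  obtain ⟨K, s, hs, hK⟩ := (hf.contDiffAt (hO.mem_nhds hz₁O)).exists_lipschitzOnWith
  have d₁ := g₁.hasDerivAt_chart hs₁
  have d₂ := g₂.hasDerivAt_chart hs₂
  have m₁ : ∀ᶠ t in 𝓝 r, HasDerivAt z₁ (f (z₁ t)) t ∧ z₁ t ∈ s := by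
    filter_upwards [h₁, eventually_mem_chart_source g₁.1.continuousAt hs₁,
      d₁.continuousAt.eventually hs] with t ht ht' ht''
    exact ⟨ht.hasDerivAt_chart ht', ht''⟩
  have m₂ : ∀ᶠ t in 𝓝 r, HasDerivAt z₂ (f (z₂ t)) t ∧ z₂ t ∈ s := by
    filter_upwards [h₂, eventually_mem_chart_source g₂.1.continuousAt hs₂,
      d₂.continuousAt.eventually (by rw [hz] at hs; exact hs)] with t ht ht' ht''
    exact ⟨ht.hasDerivAt_chart ht', ht''⟩
  have := ODE_solution_unique_of_eventually (v := fun _ ↦ f) (s := fun _ ↦ s)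
    (Filter.Eventually.of_forall fun _ ↦ hK) m₁ m₂ hz
  filter_upwards [this, eventually_mem_chart_source g₁.1.continuousAt hs₁,
    eventually_mem_chart_source g₂.1.continuousAt hs₂] with t ht ht₁ ht₂
  exact (extChartAt 𝓘(ℝ, E) p).injOn ht₁ ht₂ (congrArg Prod.fst ht)

end RiemannianGeodesics

/-! ### Constant speed, uniqueness and extension of geodesics -/

section GeodesicCompleteness

-- normed-space instances on iterated spaces of continuous linear maps need a deeper search
set_option maxSynthPendingDepth 3

variable {E : Type*} [NormedAddCommGroup E] [NormedSpace ℝ E]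
  {M : Type*} [TopologicalSpace M] [ChartedSpace E M] [IsManifold 𝓘(ℝ, E) ∞ M]
  (σ : ContMDiffRiemannianMetric 𝓘(ℝ, E) ∞ E (fun x : M ↦ TangentSpace 𝓘(ℝ, E) x))

/-- The squared length of a tangent vector. -/
def energy (X : TangentBundle 𝓘(ℝ, E) M) : ℝ := σ.inner X.1 X.2 X.2

theorem energy_eq_chartMetric {p : M} {X : TangentBundle 𝓘(ℝ, E) M}
    (hX : X.1 ∈ (extChartAt 𝓘(ℝ, E) p).source) :
    energy σ X = chartMetric σ p (chartState p X).1 (chartState p X).2 (chartState p X).2 :=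
  (chartMetric_mfderiv σ p hX X.2 X.2).symm

theorem energy_nonneg (X : TangentBundle 𝓘(ℝ, E) M) : 0 ≤ energy σ X := by
  unfold energy
  by_cases h : X.2 = 0
  · rw [h]
    exact (map_zero (σ.inner X.1 0)).ge
  · exact (σ.pos _ _ h).le

variable [FiniteDimensional ℝ E]

variable {σ} in
/-- Geodesics have constant speed. -/
theorem hasDerivAt_energy_velocity {c : ℝ → M} {r : ℝ}
    (h : ∀ᶠ t in 𝓝 r, IsGeodesicAt (formField σ) c t) :
    HasDerivAt (fun t ↦ energy σ (velocity 𝓘(ℝ, E) c t)) 0 r := by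
  set p := c r
  have hr : c r ∈ (extChartAt 𝓘(ℝ, E) p).source := mem_extChartAt_source p
  set x : ℝ → E := fun t ↦ extChartAt 𝓘(ℝ, E) p (c t)
  have g := h.self_of_nhds
  have hd := g.hasDerivAt_chart hr
  have hxr : x r ∈ (extChartAt 𝓘(ℝ, E) p).target := (extChartAt 𝓘(ℝ, E) p).map_source hr
  have hx1 : HasDerivAt x (deriv x r) r := hd.fst
  have hx2 : HasDerivAt (deriv x) (deriv (deriv x) r) r :=
    have h : HasDerivAt (deriv x) _ r := hd.snd
    h.differentiableAt.hasDerivAt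
  have hB := differentiableAt_chartMetric σ hxr
  have e : (fun t ↦ energy σ (velocity 𝓘(ℝ, E) c t))
      =ᶠ[𝓝 r] fun t ↦ chartMetric σ p (x t) (deriv x t) (deriv x t) := by
    filter_upwards [h, eventually_mem_chart_source g.1.continuousAt hr] with t ht ht'
    rw [energy_eq_chartMetric σ (p := p) ht',
      chartState_velocity (ht.1.mdifferentiableAt (by norm_num)) ht']
  refine HasDerivAt.congr_of_eventuallyEq ?_ e
  have h3 : HasDerivAt (fun t ↦ chartMetric σ p (x t)) _ r := hB.hasFDerivAt.comp_hasDerivAt r hx1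
  have h4 := (h3.clm_apply hx2).clm_apply hx2
  refine h4.congr_deriv ?_
  have h5 := h.self_of_nhds.2 p hr (deriv x r)
  have h6 : inChart (formField σ) p = fun y u v ↦ chartMetric σ p y u v := by
    funext y u v
    exact inChart_eq_chartMetric σ p y u v
  rw [h6] at h5
  change chartMetric σ p (x r) (deriv (deriv x) r) (deriv x r)
    + christoffel₁ (fun y u v ↦ chartMetric σ p y u v) (x r) (deriv x r) (deriv x r)
      (deriv x r) = 0 at h5
  simp only [christoffel₁, fderiv_bilin_apply hB] at h5
  simp only [add_apply]
  rw [chartMetric_symm σ p (x r) (deriv x r) (deriv (deriv x) r)]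
  linarith

variable {σ} in
theorem energy_velocity_eq {c : ℝ → M} {a b : ℝ}
    (h : ∀ t ∈ Ioo a b, IsGeodesicAt (formField σ) c t) {s t : ℝ} (hs : s ∈ Ioo a b)
    (ht : t ∈ Ioo a b) :
    energy σ (velocity 𝓘(ℝ, E) c s) = energy σ (velocity 𝓘(ℝ, E) c t) := by
  have hd : ∀ t ∈ Ioo a b, HasDerivAt (fun t ↦ energy σ (velocity 𝓘(ℝ, E) c t)) 0 t := fun t ht ↦ by
    refine hasDerivAt_energy_velocity ?_
    filter_upwards [isOpen_Ioo.mem_nhds ht] with s hs using h s hs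
  exact isOpen_Ioo.is_const_of_deriv_eq_zero isPreconnected_Ioo
    (fun t ht ↦ (hd t ht).differentiableAt.differentiableWithinAt)
    (fun t ht ↦ (hd t ht).deriv) hs ht

variable {σ} in
/-- Two geodesics on an interval that have the same velocity at one parameter coincide. -/
theorem eqOn_of_velocity_eq [T2Space M] {c₁ c₂ : ℝ → M} {a b s : ℝ} (hs : s ∈ Ioo a b)
    (h₁ : ∀ t ∈ Ioo a b, IsGeodesicAt (formField σ) c₁ t)
    (h₂ : ∀ t ∈ Ioo a b, IsGeodesicAt (formField σ) c₂ t)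
    (hv : velocity 𝓘(ℝ, E) c₁ s = velocity 𝓘(ℝ, E) c₂ s) : EqOn c₁ c₂ (Ioo a b) := by
  have ev : ∀ {c : ℝ → M}, (∀ t ∈ Ioo a b, IsGeodesicAt (formField σ) c t) → ∀ t ∈ Ioo a b,
      ∀ᶠ u in 𝓝 t, IsGeodesicAt (formField σ) c u := fun h t ht ↦ by
    filter_upwards [isOpen_Ioo.mem_nhds ht] with u hu using h u hu
  set A : Set ℝ := {t | c₁ =ᶠ[𝓝 t] c₂}
  have hA : IsOpen A := isOpen_setOfPred_eventually_nhds
  have hsub : Ioo a b ⊆ A := by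
    refine isPreconnected_Ioo.subset_of_closure_inter_subset hA
      ⟨s, hs, eventuallyEq_of_velocity_eq (ev h₁ s hs) (ev h₂ s hs) hv⟩ ?_
    rintro t ⟨htA, ht⟩
    have hfreq : ∃ᶠ u in 𝓝 t, c₁ =ᶠ[𝓝 u] c₂ := mem_closure_iff_frequently.1 htA
    have g₁ := h₁ t ht
    have g₂ := h₂ t ht
    have hpt : c₁ t = c₂ t := tendsto_nhds_unique_of_frequently_eq g₁.1.continuousAt
      g₂.1.continuousAt (hfreq.mono fun u hu ↦ hu.eq_of_nhds)
    have hs₁ : c₁ t ∈ (extChartAt 𝓘(ℝ, E) (c₁ t)).source := mem_extChartAt_source _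
    have hs₂ : c₂ t ∈ (extChartAt 𝓘(ℝ, E) (c₁ t)).source := hpt ▸ hs₁
    have hz := tendsto_nhds_unique_of_frequently_eq (g₁.hasDerivAt_chart hs₁).continuousAt
      (g₂.hasDerivAt_chart hs₂).continuousAt (hfreq.mono fun u hu ↦ by
        have e : (fun t' ↦ extChartAt 𝓘(ℝ, E) (c₁ t) (c₁ t'))
            =ᶠ[𝓝 u] fun t' ↦ extChartAt 𝓘(ℝ, E) (c₁ t) (c₂ t') := by
          filter_upwards [hu] with t' ht'
          rw [ht']
        exact Prod.ext e.eq_of_nhds e.deriv_eq)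
    refine eventuallyEq_of_velocity_eq (ev h₁ t ht) (ev h₂ t ht) ?_
    refine chartState_injOn (p := c₁ t) hs₁ hs₂ ?_
    rw [chartState_velocity (g₁.1.mdifferentiableAt (by norm_num)) hs₁,
      chartState_velocity (g₂.1.mdifferentiableAt (by norm_num)) hs₂]
    exact hz
  exact fun t ht ↦ (hsub ht).eq_of_nhds

/-- Integral curves that start in a compact set have a common interval of existence. -/
theorem exists_integralCurve_of_isCompact {F : Type*} [NormedAddCommGroup F] [NormedSpace ℝ F]
    [CompleteSpace F] {f : F → F} {O K : Set F} (hO : IsOpen O) (hf : ContDiffOn ℝ 1 f O)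
    (hK : IsCompact K) (hKO : K ⊆ O) :
    ∃ δ > (0 : ℝ), ∀ z ∈ K, ∃ α : ℝ → F, α 0 = z ∧
      ∀ t ∈ Ioo (-δ) δ, HasDerivAt α (f (α t)) t ∧ α t ∈ O := by
  refine hK.induction_on (p := fun S ↦ ∃ δ > (0 : ℝ), ∀ z ∈ S, ∃ α : ℝ → F, α 0 = z ∧
      ∀ t ∈ Ioo (-δ) δ, HasDerivAt α (f (α t)) t ∧ α t ∈ O) ⟨1, one_pos, by simp⟩ ?_ ?_ ?_
  · rintro S T hST ⟨δ, hδ, h⟩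
    exact ⟨δ, hδ, fun z hz ↦ h z (hST hz)⟩
  · rintro S T ⟨δ, hδ, h⟩ ⟨δ', hδ', h'⟩
    refine ⟨min δ δ', lt_min hδ hδ', ?_⟩
    have hl := min_le_left δ δ'
    have hr := min_le_right δ δ'
    rintro z (hz | hz)
    · obtain ⟨α, h0, hα⟩ := h z hz
      exact ⟨α, h0, fun t ht ↦ hα t ⟨by linarith [ht.1], by linarith [ht.2]⟩⟩
    · obtain ⟨α, h0, hα⟩ := h' z hz
      exact ⟨α, h0, fun t ht ↦ hα t ⟨by linarith [ht.1], by linarith [ht.2]⟩⟩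
  · intro z hz
    obtain ⟨δ, hδ, h⟩ := exists_integralCurve_mem hO hf (hKO hz)
    exact ⟨_, mem_nhdsWithin_of_mem_nhds h, δ, hδ, fun z hz ↦ hz⟩

/-- Near a point, geodesics of bounded speed exist on a common interval. -/
theorem exists_geodesic_near (x : M) (C : ℝ) :
    ∃ U ∈ 𝓝 x, ∃ δ > (0 : ℝ), ∀ X : TangentBundle 𝓘(ℝ, E) M, X.1 ∈ U → energy σ X ≤ C →
      ∃ c : ℝ → M, (∀ t ∈ Ioo (-δ) δ, IsGeodesicAt (formField σ) c t) ∧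
        velocity 𝓘(ℝ, E) c 0 = X := by
  have : CompleteSpace E := FiniteDimensional.complete ℝ E
  have : ProperSpace E := FiniteDimensional.proper ℝ E
  set y₀ := extChartAt 𝓘(ℝ, E) x x
  have hO := isOpen_extChartAt_target (I := 𝓘(ℝ, E)) x
  obtain ⟨ρ, hρ, hball⟩ := Metric.nhds_basis_closedBall.mem_iff.1
    (hO.mem_nhds (mem_extChartAt_target x))
  -- a lower bound for the metric on Euclidean unit vectors over the closed ball
  obtain ⟨m, hm, hmin⟩ : ∃ m : ℝ, 0 < m ∧ ∀ z ∈ Metric.closedBall y₀ ρ ×ˢ Metric.sphere (0 : E) 1,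
      m ≤ chartMetric σ x z.1 z.2 z.2 := by
    refine ((isCompact_closedBall y₀ ρ).prod (isCompact_sphere (0 : E) 1)).exists_forall_le' ?_ ?_
    · have h1 : ContinuousOn (fun z : E × E ↦ chartMetric σ x z.1)
          (Metric.closedBall y₀ ρ ×ˢ Metric.sphere (0 : E) 1) :=
        ((contDiffOn_chartMetric σ x).continuousOn.mono hball).comp continuousOn_fst
          fun z hz ↦ hz.1
      exact (h1.clm_apply continuousOn_snd).clm_apply continuousOn_snd
    · rintro z ⟨hz1, hz2⟩
      refine chartMetric_pos σ x (hball hz1) ?_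
      rintro h0
      rw [h0] at hz2
      simp at hz2
  set R := Real.sqrt (C / m)
  have hbound : ∀ y ∈ Metric.closedBall y₀ ρ, ∀ u : E, chartMetric σ x y u u ≤ C → ‖u‖ ≤ R := by
    intro y hy u hu
    refine Real.le_sqrt_of_sq_le ?_
    rw [le_div_iff₀ hm]
    by_cases h0 : u = 0
    · have : chartMetric σ x y u u = 0 := by simp [h0]
      rw [h0, norm_zero]
      linarith
    · have hn : ‖u‖ ≠ 0 := norm_ne_zero_iff.2 h0
      have h1 := hmin (y, ‖u‖⁻¹ • u) ⟨hy, by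
        rw [mem_sphere_zero_iff_norm, norm_smul, norm_inv, norm_norm, inv_mul_cancel₀ hn]⟩
      simp only [map_smul, smul_apply, smul_eq_mul] at h1
      have h2 : ‖u‖ ^ 2 * m ≤ ‖u‖ ^ 2 * (‖u‖⁻¹ * (‖u‖⁻¹ * chartMetric σ x y u u)) :=
        mul_le_mul_of_nonneg_left h1 (sq_nonneg _)
      have h3 : ‖u‖ ^ 2 * (‖u‖⁻¹ * (‖u‖⁻¹ * chartMetric σ x y u u)) = chartMetric σ x y u u := by
        field_simp
      linarith
  obtain ⟨δ, hδ, H⟩ := exists_integralCurve_of_isCompact (hO.prod isOpen_univ)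
    (contDiffOn_geodesicField hO (contDiffOn_chartMetric σ x)
      fun y hy u hu ↦ chartMetric_pos σ x hy hu)
    ((isCompact_closedBall y₀ ρ).prod (isCompact_closedBall (0 : E) R))
    (prod_mono hball (subset_univ _))
  refine ⟨(extChartAt 𝓘(ℝ, E) x).source ∩ extChartAt 𝓘(ℝ, E) x ⁻¹' Metric.closedBall y₀ ρ, ?_,
    δ, hδ, ?_⟩
  · exact Filter.inter_mem (extChartAt_source_mem_nhds x)
      ((continuousAt_extChartAt x).preimage_mem_nhds (Metric.closedBall_mem_nhds _ hρ))
  · rintro X ⟨hX1, hX2⟩ hXC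
    rw [energy_eq_chartMetric σ hX1] at hXC
    obtain ⟨α, hα0, hα⟩ := H (chartState x X)
      ⟨hX2, mem_closedBall_zero_iff.2 (hbound _ hX2 _ hXC)⟩
    have h0 : (0 : ℝ) ∈ Ioo (-δ) δ := ⟨by linarith, hδ⟩
    refine ⟨fun t ↦ (extChartAt 𝓘(ℝ, E) x).symm (α t).1,
      fun t ht ↦ (isGeodesicAt_of_integralCurve σ isOpen_Ioo hα ht).1, ?_⟩
    refine chartState_injOn (p := x) ((extChartAt 𝓘(ℝ, E) x).map_target (hα 0 h0).2.1) hX1 ?_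
    rw [(isGeodesicAt_of_integralCurve σ isOpen_Ioo hα h0).2, hα0]

/-- Over a compact set, geodesics of bounded speed exist on a common interval. -/
theorem exists_geodesic_of_isCompact {K : Set M} (hK : IsCompact K) (C : ℝ) :
    ∃ δ > (0 : ℝ), ∀ X : TangentBundle 𝓘(ℝ, E) M, X.1 ∈ K → energy σ X ≤ C →
      ∃ c : ℝ → M, (∀ t ∈ Ioo (-δ) δ, IsGeodesicAt (formField σ) c t) ∧
        velocity 𝓘(ℝ, E) c 0 = X := by
  refine hK.induction_on (p := fun S ↦ ∃ δ > (0 : ℝ), ∀ X : TangentBundle 𝓘(ℝ, E) M, X.1 ∈ S →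
      energy σ X ≤ C → ∃ c : ℝ → M, (∀ t ∈ Ioo (-δ) δ, IsGeodesicAt (formField σ) c t) ∧
        velocity 𝓘(ℝ, E) c 0 = X) ⟨1, one_pos, by simp⟩ ?_ ?_ ?_
  · rintro S T hST ⟨δ, hδ, h⟩
    exact ⟨δ, hδ, fun X hX ↦ h X (hST hX)⟩
  · rintro S T ⟨δ, hδ, h⟩ ⟨δ', hδ', h'⟩
    refine ⟨min δ δ', lt_min hδ hδ', ?_⟩
    have hl := min_le_left δ δ'
    have hr := min_le_right δ δ'
    rintro X (hX | hX) hXC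
    · obtain ⟨c, hc, h0⟩ := h X hX hXC
      exact ⟨c, fun t ht ↦ hc t ⟨by linarith [ht.1], by linarith [ht.2]⟩, h0⟩
    · obtain ⟨c, hc, h0⟩ := h' X hX hXC
      exact ⟨c, fun t ht ↦ hc t ⟨by linarith [ht.1], by linarith [ht.2]⟩, h0⟩
  · intro x hx
    obtain ⟨U, hU, δ, hδ, h⟩ := exists_geodesic_near σ x C
    exact ⟨U, mem_nhdsWithin_of_mem_nhds hU, δ, hδ, h⟩

variable {σ} in
/-- Gluing a geodesic to one that starts with its velocity at the parameter `s`. -/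
theorem exists_geodesic_extend {c d : ℝ → M} {ε L s δ : ℝ} (hε : 0 < ε) (hs : 0 < s) (hsL : s < L)
    (hδ : 0 < δ)
    (hc : ∀ t ∈ Ioo (-ε) L, IsGeodesicAt (formField σ) c t)
    (hd : ∀ t ∈ Ioo (-δ) δ, IsGeodesicAt (formField σ) d t)
    (hv : velocity 𝓘(ℝ, E) d 0 = velocity 𝓘(ℝ, E) c s) :
    ∃ c' : ℝ → M, (∀ t ∈ Ioo (-ε) (s + δ), IsGeodesicAt (formField σ) c' t) ∧
      velocity 𝓘(ℝ, E) c' 0 = velocity 𝓘(ℝ, E) c 0 := by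
  set d' : ℝ → M := fun t ↦ d (t + -s)
  have hd' : ∀ t ∈ Ioo (s - δ) (s + δ), IsGeodesicAt (formField σ) d' t := fun t ht ↦
    (hd (t + -s) ⟨by linarith [ht.1], by linarith [ht.2]⟩).comp_add_const
  have hv' : velocity 𝓘(ℝ, E) c s = velocity 𝓘(ℝ, E) d' s := by
    have h0 := hd (s + -s) ⟨by linarith, by linarith⟩
    rw [velocity_comp_add_const (h0.1.mdifferentiableAt (by norm_num)), add_neg_cancel, hv]
  have hsc : s ∈ Ioo (-ε) L := ⟨by linarith, hsL⟩
  have hsd : s ∈ Ioo (s - δ) (s + δ) := ⟨by linarith, by linarith⟩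
  have heq : c =ᶠ[𝓝 s] d' := by
    refine eventuallyEq_of_velocity_eq (σ := σ) ?_ ?_ hv'
    · filter_upwards [isOpen_Ioo.mem_nhds hsc] with t ht using hc t ht
    · filter_upwards [isOpen_Ioo.mem_nhds hsd] with t ht using hd' t ht
  classical
  set c' : ℝ → M := fun t ↦ if t < s then c t else d' t
  have hlt : ∀ t < s, c' =ᶠ[𝓝 t] c := fun t ht ↦ by
    filter_upwards [Iio_mem_nhds ht] with u hu
    exact if_pos hu
  refine ⟨c', fun t ht ↦ ?_, velocity_congr (hlt 0 hs)⟩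
  rcases lt_trichotomy t s with h | h | h
  · exact (hc t ⟨ht.1, h.trans hsL⟩).congr (hlt t h)
  · subst h
    refine (hc t hsc).congr ?_
    filter_upwards [heq] with u hu
    by_cases h : u < t
    · exact if_pos h
    · exact (if_neg h).trans hu.symm
  · refine (hd' t ⟨by linarith, ht.2⟩).congr ?_
    filter_upwards [Ioi_mem_nhds h] with u hu
    exact if_neg (not_lt.2 (le_of_lt hu))

/-- **Escape lemma.** If all geodesics with initial velocity `X` stay, up to any finite parameter,
in a compact set, then there is one that is defined for all positive parameters. -/
theorem exists_geodesic_Ioi [T2Space M] (X : TangentBundle 𝓘(ℝ, E) M)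
    (hX : ∀ T > (0 : ℝ), ∃ K : Set M, IsCompact K ∧ ∀ ε > (0 : ℝ), ∀ L ∈ Ioc 0 T, ∀ c : ℝ → M,
      (∀ t ∈ Ioo (-ε) L, IsGeodesicAt (formField σ) c t) → velocity 𝓘(ℝ, E) c 0 = X →
        ∀ s ∈ Ico 0 L, c s ∈ K) :
    ∃ ε > (0 : ℝ), ∃ c : ℝ → M, (∀ t ∈ Ioi (-ε), IsGeodesicAt (formField σ) c t) ∧
      velocity 𝓘(ℝ, E) c 0 = X := by
  obtain ⟨U, hU, ε, hε, hloc⟩ := exists_geodesic_near σ X.1 (energy σ X)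
  obtain ⟨c₀, hc₀, hv₀⟩ := hloc X (mem_of_mem_nhds hU) le_rfl
  have hfinite : ∀ T > (0 : ℝ), ∃ c : ℝ → M,
      (∀ t ∈ Ioo (-ε) T, IsGeodesicAt (formField σ) c t) ∧ velocity 𝓘(ℝ, E) c 0 = X := by
    intro T hT
    obtain ⟨K, hK, hKc⟩ := hX T hT
    obtain ⟨δ, hδ, hext⟩ := exists_geodesic_of_isCompact σ hK (energy σ X)
    have hstep : ∀ n : ℕ, ∃ c : ℝ → M, (∀ t ∈ Ioo (-ε) (min T (ε + n * (δ / 2))),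
        IsGeodesicAt (formField σ) c t) ∧ velocity 𝓘(ℝ, E) c 0 = X := by
      intro n
      induction n with
      | zero =>
        refine ⟨c₀, fun t ht ↦ hc₀ t ⟨ht.1, ?_⟩, hv₀⟩
        have := lt_of_lt_of_le ht.2 (min_le_right _ _)
        simpa using this
      | succ n ih =>
        obtain ⟨c, hc, hv⟩ := ih
        set L := min T (ε + n * (δ / 2))
        have hL : 0 < L := lt_min hT (by positivity)
        set s := max (L / 2) (L - δ / 4)
        have hs : 0 < s := lt_max_of_lt_left (by linarith)
        have hsL : s < L := max_lt (by linarith) (by linarith)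
        have hs0 : s ∈ Ioo (-ε) L := ⟨by linarith, hsL⟩
        have h0 : (0 : ℝ) ∈ Ioo (-ε) L := ⟨by linarith, hL⟩
        obtain ⟨d, hd, hdv⟩ := hext (velocity 𝓘(ℝ, E) c s)
          (hKc ε hε L ⟨hL, min_le_left _ _⟩ c hc hv s ⟨hs.le, hsL⟩)
          (by rw [energy_velocity_eq hc hs0 h0, hv])
        obtain ⟨c', hc', hv'⟩ := exists_geodesic_extend hε hs hsL hδ hc hd hdv
        refine ⟨c', fun t ht ↦ hc' t ⟨ht.1, ?_⟩, hv'.trans hv⟩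
        have h1 : L - δ / 4 ≤ s := le_max_right _ _
        have h2 : min T (ε + (n + 1 : ℕ) * (δ / 2)) ≤ L + δ / 2 := by
          push_cast
          rcases min_choice T (ε + n * (δ / 2)) with h | h
          · exact (min_le_left _ _).trans (by linarith)
          · exact (min_le_right _ _).trans (by linarith)
        linarith [ht.2]
    obtain ⟨n, hn⟩ := exists_nat_gt (T / (δ / 2))
    obtain ⟨c, hc, hv⟩ := hstep n
    refine ⟨c, fun t ht ↦ hc t ⟨ht.1, lt_min ht.2 ?_⟩, hv⟩
    rw [div_lt_iff₀ (by positivity)] at hn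
    linarith [ht.2]
  choose c hc hv using fun n : ℕ ↦ hfinite (n + 1) (by positivity)
  have hcompat : ∀ m n : ℕ, ∀ t : ℝ, -ε < t → t < m + 1 → t < n + 1 → c m t = c n t := by
    intro m n t ht hm hn
    refine eqOn_of_velocity_eq (σ := σ) (s := 0) (a := -ε) (b := min (m + 1) (n + 1))
      ⟨by linarith, lt_min (by positivity) (by positivity)⟩
      (fun t ht ↦ hc m t ⟨ht.1, lt_of_lt_of_le ht.2 (min_le_left _ _)⟩)
      (fun t ht ↦ hc n t ⟨ht.1, lt_of_lt_of_le ht.2 (min_le_right _ _)⟩)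
      ((hv m).trans (hv n).symm) ⟨ht, lt_min hm hn⟩
  have hceil : ∀ t : ℝ, t < (⌈|t|⌉₊ : ℝ) + 1 := fun t ↦ by
    linarith [le_abs_self t, Nat.le_ceil |t|]
  have hev : ∀ t > -ε, (fun u ↦ c ⌈|u|⌉₊ u) =ᶠ[𝓝 t] c ⌈|t|⌉₊ := fun t ht ↦ by
    filter_upwards [Ioi_mem_nhds ht, Iio_mem_nhds (hceil t)] with u hu hu'
    exact hcompat _ _ u hu (hceil u) hu'
  refine ⟨ε, hε, fun u ↦ c ⌈|u|⌉₊ u, fun t ht ↦ (hc _ t ⟨ht, hceil t⟩).congr (hev t ht), ?_⟩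
  rw [velocity_congr (hev 0 (by simpa using hε)), hv]

end GeodesicCompleteness

/-! ### Causal curves and completeness of the slices -/

section TimeAxis

variable {t₀ : ℝ}

/-- The curve in the time axis with values `τ r` wherever these are later than `t₀`, and an
arbitrary value elsewhere. -/
def timeCurve (t₀ : ℝ) (τ : ℝ → ℝ) (r : ℝ) : timeAxis t₀ :=
  open Classical in if h : t₀ < τ r then ⟨τ r, h⟩ else ⟨t₀ + 1, by simp [timeAxis]⟩

theorem timeCurve_of_lt {τ : ℝ → ℝ} {r : ℝ} (h : t₀ < τ r) : timeCurve t₀ τ r = ⟨τ r, h⟩ :=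
  dif_pos h

theorem coe_timeCurve_eventuallyEq {τ : ℝ → ℝ} {r : ℝ} (h : t₀ < τ r) (hτ : ContinuousAt τ r) :
    (fun x ↦ (timeCurve t₀ τ x : ℝ)) =ᶠ[𝓝 r] τ := by
  filter_upwards [hτ.eventually (Ioi_mem_nhds h)] with x hx
  rw [timeCurve_of_lt hx]

theorem contMDiffAt_timeCurve {τ : ℝ → ℝ} {r : ℝ} {k : WithTop ℕ∞} (h : t₀ < τ r)
    (hτ : ContDiffAt ℝ k τ r) : ContMDiffAt 𝓘(ℝ, ℝ) 𝓘(ℝ, ℝ) k (timeCurve t₀ τ) r := by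
  have h1 : ContMDiffAt 𝓘(ℝ, ℝ) 𝓘(ℝ, ℝ) k (Subtype.val ∘ timeCurve t₀ τ) r :=
    (hτ.congr_of_eventuallyEq (coe_timeCurve_eventuallyEq h hτ.continuousAt)).contMDiffAt
  exact ChartedSpace.liftPropWithinAt_subtypeVal_comp_iff .. |>.1 h1

theorem mfderiv_timeAxis_one {γ : ℝ → timeAxis t₀} {r : ℝ}
    (h : MDifferentiableAt 𝓘(ℝ, ℝ) 𝓘(ℝ, ℝ) γ r) :
    (mfderiv 𝓘(ℝ, ℝ) 𝓘(ℝ, ℝ) γ r (1 : ℝ) : ℝ) = deriv (fun x ↦ (γ x : ℝ)) r := by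
  set D : ℝ →L[ℝ] ℝ := mfderiv 𝓘(ℝ, ℝ) 𝓘(ℝ, ℝ) γ r
  have h1 : HasFDerivWithinAt (fun x ↦ (γ x : ℝ)) D univ r := by
    have := h.hasMFDerivAt.2
    simp only [modelWithCornersSelf_coe, range_id] at this
    exact this
  exact (hasFDerivWithinAt_univ.1 h1).hasDerivAt.deriv.symm

end TimeAxis

section Causality

variable {n : ℕ} {M : Type*} [TopologicalSpace M] [ChartedSpace (EuclideanSpace ℝ (Fin n)) M]

theorem velocity_prodMk {t₀ : ℝ} {c : ℝ → M} {T : ℝ → timeAxis t₀} {r : ℝ}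
    (hc : MDifferentiableAt 𝓘(ℝ, ℝ) (𝓡 n) c r)
    (hT : MDifferentiableAt 𝓘(ℝ, ℝ) 𝓘(ℝ, ℝ) T r) :
    velocity ((𝓡 n).prod 𝓘(ℝ, ℝ)) (fun x ↦ (c x, T x)) r
      = ⟨(c r, T r), ((velocity (𝓡 n) c r).2, deriv (fun x ↦ (T x : ℝ)) r)⟩ := by
  unfold velocity
  congr 1
  rw [mfderiv_prodMk hc hT]
  refine Prod.ext rfl ?_
  change (mfderiv 𝓘(ℝ, ℝ) 𝓘(ℝ, ℝ) T r (1 : ℝ) : ℝ) = _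
  exact mfderiv_timeAxis_one hT

variable [IsManifold (𝓡 n) ∞ M]

theorem energy_smul (σ : ContMDiffRiemannianMetric (𝓡 n) ∞ (EuclideanSpace ℝ (Fin n))
    (fun x : M ↦ TangentSpace (𝓡 n) x)) (x : M) (b : ℝ) (v : TangentSpace (𝓡 n) x) :
    energy σ ⟨x, b • v⟩ = b ^ 2 * energy σ ⟨x, v⟩ := by
  simp only [energy]
  rw [map_smul, map_smul, smul_apply, smul_eq_mul, smul_eq_mul]
  ring

theorem energy_velocity_comp (σ : ContMDiffRiemannianMetric (𝓡 n) ∞ (EuclideanSpace ℝ (Fin n))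
    (fun x : M ↦ TangentSpace (𝓡 n) x)) {c : ℝ → M} {f : ℝ → ℝ} {f' r : ℝ}
    (h : MDifferentiableAt 𝓘(ℝ, ℝ) (𝓡 n) c (f r)) (hf : HasDerivAt f f' r) :
    energy σ (velocity (𝓡 n) (fun x ↦ c (f x)) r)
      = f' ^ 2 * energy σ (velocity (𝓡 n) c (f r)) := by
  rw [velocity_comp h hf]
  exact energy_smul σ _ _ _

theorem causalArc_of_energy_le (U : Universe n M) {c : ℝ → M} {τ : ℝ → ℝ}
    (hc : ∀ r ∈ Icc (0 : ℝ) 1, ContMDiffAt 𝓘(ℝ, ℝ) (𝓡 n) 1 c r) (hτ : ContDiff ℝ 1 τ)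
    (hτ₀ : ∀ r ∈ Icc (0 : ℝ) 1, U.t₀ < τ r) (hτ' : ∀ r ∈ Icc (0 : ℝ) 1, 0 < deriv τ r)
    (hle : ∀ r ∈ Icc (0 : ℝ) 1,
      U.a (τ r) ^ 2 * energy U.σ (velocity (𝓡 n) c r) ≤ deriv τ r ^ 2) :
    CausalArc U.metric U.timeForm (c 0, timeCurve U.t₀ τ 0) (c 1, timeCurve U.t₀ τ 1) := by
  refine ⟨fun r ↦ (c r, timeCurve U.t₀ τ r), rfl, rfl, fun r hr ↦ ?_⟩
  have hT := contMDiffAt_timeCurve (hτ₀ r hr) hτ.contDiffAt (r := r)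
  refine ⟨(hc r hr).prodMk hT, ?_⟩
  rw [velocity_prodMk ((hc r hr).mdifferentiableAt (by norm_num))
    (hT.mdifferentiableAt (by norm_num)),
    (coe_timeCurve_eventuallyEq (hτ₀ r hr) hτ.continuous.continuousAt).deriv_eq]
  refine ⟨?_, hτ' r hr⟩
  rw [U.metric_eq]
  have h1 := hle r hr
  simp only [timeCurve_of_lt (hτ₀ r hr), dx, dt]
  change -(deriv τ r * deriv τ r) + U.a (τ r) ^ 2 * U.σ.inner (c r) (velocity (𝓡 n) c r).2
    (velocity (𝓡 n) c r).2 ≤ 0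
  unfold energy at h1
  change U.a (τ r) ^ 2 * U.σ.inner (c r) (velocity (𝓡 n) c r).2
    (velocity (𝓡 n) c r).2 ≤ _ at h1
  linarith [sq (deriv τ r)]

/-- Regular hyperbolicity bounds the scale factor above and away from zero, as soon as there is a
nonzero vector to be measured. -/
theorem exists_scale_bound (U : Universe n M) (hreg : U.slice.RegularlyHyperbolic)
    (X : TangentBundle (𝓡 n) M) :
    ∃ C : ℝ, ∀ t, U.t₀ < t → U.a t ^ 2 * energy U.σ X ≤ C ∧ energy U.σ X / U.a t ^ 2 ≤ C := by
  by_cases hX : X.2 = 0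
  · have h0 : energy U.σ X = 0 := by
      unfold energy
      rw [hX]
      exact map_zero _
    exact ⟨0, fun t _ ↦ by simp [h0]⟩
  · obtain ⟨-, -, γ, A, D, hA, hD, h⟩ := hreg
    have he : 0 < energy U.σ X := U.σ.pos _ _ hX
    have hγ : 0 < γ.inner X.1 X.2 X.2 := γ.pos _ _ hX
    set e := energy U.σ X
    set g := γ.inner X.1 X.2 X.2
    have hb : ∀ t, U.t₀ < t → A * g ≤ U.a t ^ 2 * e ∧ U.a t ^ 2 * e ≤ D * g := fun t ht ↦
      h (X.1, ⟨t, ht⟩) X.2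
    refine ⟨max (D * g) (e ^ 2 / (A * g)), fun t ht ↦ ⟨le_max_of_le_left (hb t ht).2,
      le_max_of_le_right ?_⟩⟩
    have ha := U.a_pos t ht
    rw [div_le_div_iff₀ (by positivity) (by positivity)]
    nlinarith [(hb t ht).1]

/-- In a globally and regularly hyperbolic Friedmann universe, the slice metric is geodesically
complete: a causal curve can follow a geodesic of finite length and come back in bounded time, so
the geodesic stays in the projection of a causal diamond. -/
theorem exists_slice_geodesic [T2Space M] (U : Universe n M)
    (hglob : GloballyHyperbolic U.metric U.timeForm) (hreg : U.slice.RegularlyHyperbolic)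
    (X : TangentBundle (𝓡 n) M) :
    ∃ ε > (0 : ℝ), ∃ c : ℝ → M, (∀ t ∈ Ioi (-ε), IsGeodesicAt (formField U.σ) c t) ∧
      velocity (𝓡 n) c 0 = X := by
  obtain ⟨C, hC⟩ := exists_scale_bound U hreg X
  refine exists_geodesic_Ioi U.σ X fun T hT ↦ ?_
  set Δ := T * Real.sqrt C + 1
  have hΔ : 0 < Δ := by positivity
  -- light needs at most the time `Δ` for a curve of length at most `T` times the initial speed
  have hspeed : ∀ t, U.t₀ < t → ∀ s, 0 ≤ s → s ≤ T →
      U.a t ^ 2 * (s ^ 2 * energy U.σ X) ≤ Δ ^ 2 := by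
    intro t ht s hs hsT
    have h1 := (hC t ht).1
    have hC0 : 0 ≤ C := le_trans (mul_nonneg (sq_nonneg _) (energy_nonneg U.σ X)) h1
    have h2 : s ^ 2 ≤ T ^ 2 := pow_le_pow_left₀ hs hsT 2
    have h3 : s ^ 2 * (U.a t ^ 2 * energy U.σ X) ≤ T ^ 2 * C :=
      mul_le_mul h2 h1 (mul_nonneg (sq_nonneg _) (energy_nonneg U.σ X)) (sq_nonneg _)
    have h4 : T ^ 2 * C = (T * Real.sqrt C) ^ 2 := by rw [mul_pow, Real.sq_sqrt hC0]
    have h5 : 0 ≤ T * Real.sqrt C := by positivity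
    have h6 : (T * Real.sqrt C) ^ 2 ≤ Δ ^ 2 := pow_le_pow_left₀ h5 (by simp [Δ]) 2
    linarith
  set t₁ := U.t₀ + 1
  set time : ℝ → timeAxis U.t₀ := fun t ↦ timeCurve U.t₀ id t
  refine ⟨Prod.fst '' {z | CausallyPrecedes U.metric U.timeForm (X.1, time t₁) z ∧
    CausallyPrecedes U.metric U.timeForm z (X.1, time (t₁ + Δ + Δ))},
    (hglob.2 _ _).image continuous_fst, ?_⟩
  intro ε hε L hL c hc hv s hs
  have hc0 : c 0 = X.1 := congrArg TotalSpace.proj hv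
  have h0 : (0 : ℝ) ∈ Ioo (-ε) L := ⟨by linarith, hL.1⟩
  have haff : ∀ b v r : ℝ, HasDerivAt (fun r : ℝ ↦ b + v * r) v r := fun b v r ↦ by
    simpa using ((hasDerivAt_id r).const_mul v).const_add b
  have haffC : ∀ b v : ℝ, ContDiff ℝ 1 (fun r : ℝ ↦ b + v * r) := fun b v ↦
    contDiff_const.add (contDiff_const.mul contDiff_id)
  -- a causal arc along a reparametrised piece of the geodesic, from the time `b` to `b + Δ`
  have harc : ∀ b u v : ℝ, U.t₀ < b → |v| ≤ T →
      (∀ r ∈ Icc (0 : ℝ) 1, u + v * r ∈ Ioo (-ε) L) →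
      CausalArc U.metric U.timeForm (c u, time b) (c (u + v), time (b + Δ)) := by
    intro b u v hb hvT hI
    have hbr : ∀ r ∈ Icc (0 : ℝ) 1, U.t₀ < b + Δ * r := fun r hr ↦ by
      nlinarith [mul_nonneg hΔ.le hr.1]
    have key := causalArc_of_energy_le U (c := fun r ↦ c (u + v * r)) (τ := fun r ↦ b + Δ * r)
      (fun r hr ↦ ContMDiffAt.comp r ((hc _ (hI r hr)).1.of_le (by norm_num))
        (haffC u v).contMDiff.contMDiffAt) (haffC b Δ) hbr
      (fun r _ ↦ by rw [(haff b Δ r).deriv]; exact hΔ)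
      (fun r hr ↦ by
        rw [(haff b Δ r).deriv, energy_velocity_comp U.σ (f := fun r ↦ u + v * r)
            ((hc _ (hI r hr)).1.mdifferentiableAt (by norm_num)) (haff u v r),
          energy_velocity_eq hc (hI r hr) h0, hv, ← sq_abs v]
        exact hspeed _ (hbr r hr) _ (abs_nonneg _) hvT)
    have e0 : timeCurve U.t₀ (fun r ↦ b + Δ * r) 0 = time b := by simp [time, timeCurve]
    have e1 : timeCurve U.t₀ (fun r ↦ b + Δ * r) 1 = time (b + Δ) := by simp [time, timeCurve]
    simp only [mul_zero, mul_one, add_zero] at key e0 e1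
    rwa [e0, e1] at key
  have hsT : |s| ≤ T := by rw [abs_of_nonneg hs.1]; exact hs.2.le.trans hL.2
  have hsI : ∀ r ∈ Icc (0 : ℝ) 1, s * r ∈ Ioo (-ε) L := fun r hr ↦
    ⟨by linarith [mul_nonneg hs.1 hr.1], by nlinarith [hs.1, hs.2, hr.1, hr.2]⟩
  refine ⟨(c s, time (t₁ + Δ)), ⟨?_, ?_⟩, rfl⟩
  · have := harc t₁ 0 s (by simp [t₁]) hsT (fun r hr ↦ by rw [zero_add]; exact hsI r hr)
    rw [zero_add, hc0] at this
    exact Relation.ReflTransGen.single this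
  · have := harc (t₁ + Δ) s (-s) (by simp only [t₁]; linarith) (by rwa [abs_neg])
      (fun r hr ↦ by
        have := hsI (1 - r) ⟨by linarith [hr.2], by linarith [hr.1]⟩
        rwa [mul_sub, mul_one, sub_eq_add_neg, ← neg_mul] at this)
    rw [add_neg_cancel, hc0] at this
    exact Relation.ReflTransGen.single this

end Causality

/-! ### The spacetime metric in product charts -/

section TimeChart

variable {t₀ : ℝ}

theorem mem_target_timeAxis (s : timeAxis t₀) {τ : ℝ} (hτ : t₀ < τ) :
    τ ∈ (extChartAt 𝓘(ℝ, ℝ) s).target := by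
  have h : (⟨τ, hτ⟩ : timeAxis t₀) ∈ (extChartAt 𝓘(ℝ, ℝ) s).source := by
    rw [extChartAt_source, TopologicalSpace.Opens.chartAt_eq]
    simp [chartAt_self_eq]
  exact (extChartAt 𝓘(ℝ, ℝ) s).map_source h

theorem coe_extChartAt_timeAxis_symm (s : timeAxis t₀) {τ : ℝ} (hτ : t₀ < τ) :
    ((extChartAt 𝓘(ℝ, ℝ) s).symm τ : ℝ) = τ :=
  (extChartAt 𝓘(ℝ, ℝ) s).right_inv (mem_target_timeAxis s hτ)

theorem mfderiv_extChartAt_timeAxis_symm (s : timeAxis t₀) {τ : ℝ} (hτ : t₀ < τ) (α : ℝ) :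
    (mfderiv 𝓘(ℝ, ℝ) 𝓘(ℝ, ℝ) (extChartAt 𝓘(ℝ, ℝ) s).symm τ α : ℝ) = α := by
  have hd := mdifferentiableAt_chart_symm (mem_target_timeAxis s hτ)
  have h1 := mfderiv_timeAxis_one hd
  have h2 : (fun x ↦ ((extChartAt 𝓘(ℝ, ℝ) s).symm x : ℝ)) =ᶠ[𝓝 τ] id := by
    filter_upwards [Ioi_mem_nhds hτ] with x hx using coe_extChartAt_timeAxis_symm s hx
  rw [h2.deriv_eq, deriv_id] at h1
  have h3 := (show ℝ →L[ℝ] ℝ from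
    mfderiv 𝓘(ℝ, ℝ) 𝓘(ℝ, ℝ) (extChartAt 𝓘(ℝ, ℝ) s).symm τ).map_smul α 1
  rw [smul_eq_mul, mul_one] at h3
  refine h3.trans ?_
  refine (congrArg (fun z : ℝ ↦ α * z) h1).trans (mul_one α)

end TimeChart

section WarpedProduct

variable {n : ℕ} {M : Type*} [TopologicalSpace M] [ChartedSpace (EuclideanSpace ℝ (Fin n)) M]
  [IsManifold (𝓡 n) ∞ M] (U : Universe n M)

/-- The spacetime metric in a product chart. -/
theorem inChart_metric (p : M × timeAxis U.t₀) {y : EuclideanSpace ℝ (Fin n)} {τ : ℝ}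
    (hy : y ∈ (extChartAt (𝓡 n) p.1).target) (hτ : U.t₀ < τ) (u v : EuclideanSpace ℝ (Fin n))
    (α β : ℝ) :
    inChart U.metric p (y, τ) (u, α) (v, β)
      = -(α * β) + U.a τ ^ 2 * chartMetric U.σ p.1 y u v := by
  have hsymm : ⇑(extChartAt ((𝓡 n).prod 𝓘(ℝ, ℝ)) p).symm
      = Prod.map (extChartAt (𝓡 n) p.1).symm (extChartAt 𝓘(ℝ, ℝ) p.2).symm := by
    rw [extChartAt_prod]
    rfl
  have hfst : HasMFDerivAt 𝓘(ℝ, EuclideanSpace ℝ (Fin n) × ℝ) (𝓡 n)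
      (Prod.fst : EuclideanSpace ℝ (Fin n) × ℝ → _) (y, τ) _ := hasFDerivAt_fst.hasMFDerivAt
  have hsnd : HasMFDerivAt 𝓘(ℝ, EuclideanSpace ℝ (Fin n) × ℝ) 𝓘(ℝ, ℝ)
      (Prod.snd : EuclideanSpace ℝ (Fin n) × ℝ → _) (y, τ) _ := hasFDerivAt_snd.hasMFDerivAt
  have hd := ((HasMFDerivAt.comp (y, τ) (mdifferentiableAt_chart_symm hy).hasMFDerivAt hfst).prodMk
    (HasMFDerivAt.comp (y, τ) (mdifferentiableAt_chart_symm
      (mem_target_timeAxis p.2 hτ)).hasMFDerivAt hsnd)).mfderiv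
  unfold inChart
  rw [hsymm, U.metric_eq]
  erw [hd]
  let D : ℝ →L[ℝ] ℝ := mfderiv 𝓘(ℝ, ℝ) 𝓘(ℝ, ℝ) (extChartAt 𝓘(ℝ, ℝ) p.2).symm τ
  have h1 : D α = α := mfderiv_extChartAt_timeAxis_symm p.2 hτ α
  have h2 : D β = β := mfderiv_extChartAt_timeAxis_symm p.2 hτ β
  rw [← inChart_eq_chartMetric]
  change -(D α * D β) + U.a ((extChartAt 𝓘(ℝ, ℝ) p.2).symm τ : ℝ) ^ 2 * _ = _
  rw [coe_extChartAt_timeAxis_symm p.2 hτ, h1, h2]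
  rfl

end WarpedProduct

/-! ### Geodesics of the warped product -/

section WarpedGeodesics

-- normed-space instances on iterated spaces of continuous linear maps need a deeper search
set_option maxSynthPendingDepth 3

variable {n : ℕ} {M : Type*} [TopologicalSpace M] [ChartedSpace (EuclideanSpace ℝ (Fin n)) M]
  [IsManifold (𝓡 n) ∞ M] (U : Universe n M)

theorem Universe.hasDerivAt_a {t : ℝ} (ht : U.t₀ < t) : HasDerivAt U.a (deriv U.a t) t :=
  ((U.a_smooth.contDiffAt (Ioi_mem_nhds ht)).differentiableAt (by simp)).hasDerivAt

theorem fderiv_inChart_metric (p : M × timeAxis U.t₀) {y : EuclideanSpace ℝ (Fin n)} {τ : ℝ}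
    (hy : y ∈ (extChartAt (𝓡 n) p.1).target) (hτ : U.t₀ < τ) (u v h : EuclideanSpace ℝ (Fin n))
    (α β η : ℝ) :
    fderiv ℝ (fun z : EuclideanSpace ℝ (Fin n) × ℝ ↦ inChart U.metric p z (u, α) (v, β)) (y, τ)
        (h, η)
      = 2 * U.a τ * deriv U.a τ * η * chartMetric U.σ p.1 y u v
        + U.a τ ^ 2 * fderiv ℝ (chartMetric U.σ p.1) y h u v := by
  have e : (fun z : EuclideanSpace ℝ (Fin n) × ℝ ↦ inChart U.metric p z (u, α) (v, β))
      =ᶠ[𝓝 (y, τ)] fun z ↦ -(α * β) + U.a z.2 ^ 2 * chartMetric U.σ p.1 z.1 u v := by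
    filter_upwards [prod_mem_nhds ((isOpen_extChartAt_target p.1).mem_nhds hy)
      (Ioi_mem_nhds hτ)] with z hz
    exact inChart_metric U p hz.1 hz.2 u v α β
  have hB : HasFDerivAt (fun z : EuclideanSpace ℝ (Fin n) × ℝ ↦ chartMetric U.σ p.1 z.1) _ (y, τ) :=
    HasFDerivAt.comp (f := Prod.fst) (g := chartMetric U.σ p.1) (y, τ)
      (differentiableAt_chartMetric U.σ hy).hasFDerivAt hasFDerivAt_fst
  have ha : HasFDerivAt (fun z : EuclideanSpace ℝ (Fin n) × ℝ ↦ U.a z.2) _ (y, τ) :=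
    HasFDerivAt.comp (f := Prod.snd) (g := U.a) (y, τ) (U.hasDerivAt_a hτ).hasFDerivAt
      hasFDerivAt_snd
  have hF := ((ha.pow 2).mul ((hB.clm_apply (hasFDerivAt_const u _)).clm_apply
    (hasFDerivAt_const v _))).const_add (-(α * β))
  rw [e.fderiv_eq]
  have hF' : HasFDerivAt (fun z : EuclideanSpace ℝ (Fin n) × ℝ ↦
    -(α * β) + U.a z.2 ^ 2 * chartMetric U.σ p.1 z.1 u v) _ (y, τ) := hF
  rw [hF'.fderiv]
  simp
  ring

theorem christoffel₁_metric (p : M × timeAxis U.t₀) {y : EuclideanSpace ℝ (Fin n)} {τ : ℝ}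
    (hy : y ∈ (extChartAt (𝓡 n) p.1).target) (hτ : U.t₀ < τ) (u w : EuclideanSpace ℝ (Fin n))
    (α ζ : ℝ) :
    christoffel₁ (inChart U.metric p) (y, τ) (u, α) (u, α) (w, ζ)
      = U.a τ ^ 2 * christoffel₁ (fun y u v ↦ chartMetric U.σ p.1 y u v) y u u w
        + U.a τ * deriv U.a τ *
          (2 * α * chartMetric U.σ p.1 y u w - ζ * chartMetric U.σ p.1 y u u) := by
  simp only [christoffel₁, fderiv_inChart_metric U p hy hτ,
    fderiv_bilin_apply (differentiableAt_chartMetric U.σ hy)]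
  ring

/-- **Geodesics of the warped product.** A curve `x ↦ (c (f x), τ x)` over a geodesic `c` of the
slice metric is a geodesic of the spacetime if `f` and `τ` solve the two scalar equations. -/
theorem isGeodesicAt_metric {c : ℝ → M} {f τ : ℝ → ℝ} {r : ℝ}
    (hc : IsGeodesicAt (formField U.σ) c (f r)) (hf : ContDiffAt ℝ 2 f r) (hτ : ContDiffAt ℝ 2 τ r)
    (hτr : U.t₀ < τ r)
    (h₁ : U.a (τ r) * deriv (deriv f) r + 2 * deriv U.a (τ r) * deriv τ r * deriv f r = 0)
    (h₂ : deriv (deriv τ) r + U.a (τ r) * deriv U.a (τ r) *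
      (deriv f r ^ 2 * energy U.σ (velocity (𝓡 n) c (f r))) = 0) :
    IsGeodesicAt U.metric (fun x ↦ (c (f x), timeCurve U.t₀ τ x)) r := by
  refine ⟨(ContMDiffAt.comp r hc.1 hf.contMDiffAt).prodMk (contMDiffAt_timeCurve hτr hτ), ?_⟩
  rintro p hr ⟨w, ζ⟩
  have hr1 : c (f r) ∈ (extChartAt (𝓡 n) p.1).source := by
    rw [extChartAt_prod] at hr
    exact hr.1
  set x : ℝ → EuclideanSpace ℝ (Fin n) := fun t ↦ extChartAt (𝓡 n) p.1 (c t)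
  have hx : ContDiffAt ℝ 2 x (f r) := contDiffAt_chart_comp ENat.LEInfty.out hc.1 hr1
  have hxr : x (f r) ∈ (extChartAt (𝓡 n) p.1).target := (extChartAt (𝓡 n) p.1).map_source hr1
  have hext : ∀ t, extChartAt ((𝓡 n).prod 𝓘(ℝ, ℝ)) p (c (f t), timeCurve U.t₀ τ t)
      = (x (f t), (timeCurve U.t₀ τ t : ℝ)) := fun t ↦ by
    rw [extChartAt_prod]
    rfl
  have e : (fun t ↦ extChartAt ((𝓡 n).prod 𝓘(ℝ, ℝ)) p (c (f t), timeCurve U.t₀ τ t))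
      =ᶠ[𝓝 r] fun t ↦ (x (f t), τ t) := by
    filter_upwards [coe_timeCurve_eventuallyEq hτr hτ.continuousAt] with t ht
    rw [hext, ht]
  have dd : ∀ {F : Type} [NormedAddCommGroup F] [NormedSpace ℝ F] {g : ℝ → F} {s : ℝ},
      ContDiffAt ℝ 2 g s → HasDerivAt g (deriv g s) s ∧
        HasDerivAt (deriv g) (deriv (deriv g) s) s := fun hg ↦ by
    refine ⟨(hg.differentiableAt (by norm_num)).hasDerivAt, DifferentiableAt.hasDerivAt ?_⟩
    exact ((hg.fderiv_right (m := 1) (by norm_num)).differentiableAt (by norm_num)).clm_apply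
      (differentiableAt_const (1 : ℝ))
  have e' : deriv (fun t ↦ (x (f t), τ t)) =ᶠ[𝓝 r]
      fun t ↦ (deriv f t • deriv x (f t), deriv τ t) := by
    filter_upwards [hf.eventually (by norm_num), hτ.eventually (by norm_num),
      hf.continuousAt.eventually (hx.eventually (by norm_num))] with t ht1 ht2 ht3
    exact (((dd ht3).1.scomp t (dd ht1).1).prodMk (dd ht2).1).deriv
  have e'' : deriv (deriv fun t ↦ (x (f t), τ t)) r
      = (deriv f r • (deriv f r • deriv (deriv x) (f r)) + deriv (deriv f) r • deriv x (f r),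
        deriv (deriv τ) r) := by
    rw [e'.deriv_eq]
    exact (((dd hf).2.smul ((dd hx).2.scomp r (dd hf).1)).prodMk (dd hτ).2).deriv
  have hgeo := hc.2 p.1 hr1 w
  have hinC : inChart (formField U.σ) p.1 = fun y u v ↦ chartMetric U.σ p.1 y u v := by
    funext y u v
    exact inChart_eq_chartMetric U.σ p.1 y u v
  rw [hinC] at hgeo
  change chartMetric U.σ p.1 (x (f r)) (deriv (deriv x) (f r)) w
    + christoffel₁ (fun y u v ↦ chartMetric U.σ p.1 y u v) (x (f r)) (deriv x (f r))
      (deriv x (f r)) w = 0 at hgeo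
  rw [energy_eq_chartMetric U.σ (p := p.1) hr1,
    chartState_velocity (hc.1.mdifferentiableAt (by norm_num)) hr1] at h₂
  change _ + _ * (_ * chartMetric U.σ p.1 (x (f r)) (deriv x (f r)) (deriv x (f r))) = 0 at h₂
  rw [e.deriv.deriv_eq, e.deriv_eq, e'', e'.eq_of_nhds, e.eq_of_nhds,
    inChart_metric U p hxr hτr, christoffel₁_metric U p hxr hτr]
  have hhom : christoffel₁ (fun y u v ↦ chartMetric U.σ p.1 y u v) (x (f r))
      (deriv f r • deriv x (f r)) (deriv f r • deriv x (f r)) w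
      = deriv f r ^ 2 * christoffel₁ (fun y u v ↦ chartMetric U.σ p.1 y u v) (x (f r))
        (deriv x (f r)) (deriv x (f r)) w := by
    simp only [christoffel₁, fderiv_bilin_apply (differentiableAt_chartMetric U.σ hxr)]
    simp only [map_smul, smul_apply, smul_eq_mul]
    ring
  rw [hhom]
  simp only [map_add, map_smul, smul_apply, add_apply, smul_eq_mul]
  linear_combination (-ζ) * h₂ + U.a (τ r) ^ 2 * deriv f r ^ 2 * hgeo
    + U.a (τ r) * chartMetric U.σ p.1 (x (f r)) (deriv x (f r)) w * h₁

end WarpedGeodesics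

section ScalarEquations

theorem exists_primitive {g : ℝ → ℝ} {b t₁ : ℝ} (hb : b < t₁) (hg : ContinuousOn g (Ioi b)) :
    ∃ F : ℝ → ℝ, F t₁ = 0 ∧ ∀ t > b, HasDerivAt F (g t) t := by
  refine ⟨fun t ↦ ∫ x in t₁..t, g x, by simp, fun t ht ↦ ?_⟩
  have hsub : uIcc t₁ t ⊆ Ioi b := fun x hx ↦ lt_of_lt_of_le (lt_min hb ht) hx.1
  refine intervalIntegral.integral_hasDerivAt_right (hg.mono hsub).intervalIntegrable ?_
    (hg.continuousAt (Ioi_mem_nhds ht))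
  exact hg.stronglyMeasurableAtFilter isOpen_Ioi t ht

/-- The autonomous equation `τ' = h(τ)` with a bounded positive right-hand side has solutions for
all positive times. -/
theorem exists_autonomous_solution {h : ℝ → ℝ} {t₀ t₁ C : ℝ} (ht₁ : t₀ < t₁)
    (hcont : ContinuousOn h (Ioi t₀)) (hpos : ∀ t > t₀, 0 < h t) (hle : ∀ t > t₀, h t ≤ C) :
    ∃ ε > (0 : ℝ), ∃ τ : ℝ → ℝ, τ 0 = t₁ ∧ ∀ s > -ε, t₀ < τ s ∧ HasDerivAt τ (h (τ s)) s := by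
  obtain ⟨F, hF₁, hF⟩ := exists_primitive ht₁
    (hcont.inv₀ fun t ht ↦ (hpos t ht).ne')
  have hC : 0 < C := (hpos t₁ ht₁).trans_le (hle t₁ ht₁)
  have hFc : ContinuousOn F (Ioi t₀) := fun t ht ↦ (hF t ht).continuousAt.continuousWithinAt
  have hmvt : ∀ s t, t₀ < s → s ≤ t → C⁻¹ * (t - s) ≤ F t - F s := fun s t hs hst ↦ by
    refine (convex_Ioi t₀).mul_sub_le_image_sub_of_le_deriv hFc ?_ ?_ s hs t (hs.trans_le hst) hst
    · rw [interior_Ioi]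
      exact fun x hx ↦ (hF x hx).differentiableAt.differentiableWithinAt
    · rw [interior_Ioi]
      intro x hx
      rw [(hF x hx).deriv]
      exact inv_anti₀ (hpos x hx) (hle x hx)
  have hinj : ∀ s t, t₀ < s → t₀ < t → |s - t| ≤ C * |F s - F t| := by
    intro s t hs ht
    have key : ∀ s t, t₀ < s → s ≤ t → |s - t| ≤ C * |F s - F t| := fun s t hs hst ↦ by
      have h1 := hmvt s t hs hst
      rw [inv_mul_le_iff₀ hC] at h1
      rw [abs_sub_comm s, abs_sub_comm (F s), abs_of_nonneg (sub_nonneg.2 hst)]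
      exact h1.trans (mul_le_mul_of_nonneg_left (le_abs_self _) hC.le)
    rcases le_total s t with hst | hst
    · exact key s t hs hst
    · rw [abs_sub_comm s, abs_sub_comm (F s)]
      exact key t s ht hst
  set m := (t₀ + t₁) / 2
  have hm : t₀ < m := by simp only [m]; linarith
  have hm₁ : m < t₁ := by simp only [m]; linarith
  have hFm : F m < 0 := by
    have := hmvt m t₁ hm hm₁.le
    have h2 : 0 < C⁻¹ * (t₁ - m) := mul_pos (inv_pos.2 hC) (by linarith)
    linarith
  have hsurj : ∀ s : ℝ, ∃ t, -(-F m) < s → t₀ < t ∧ F t = s := by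
    intro s
    by_cases hs : -(-F m) < s
    · rw [neg_neg] at hs
      set b := max m (m + C * (s - F m))
      have hmb : m ≤ b := le_max_left _ _
      have hb : s ≤ F b := by
        have h1 := hmvt m b hm hmb
        have h2 : m + C * (s - F m) ≤ b := le_max_right _ _
        have h3 : s - F m ≤ C⁻¹ * (b - m) := by
          rw [le_inv_mul_iff₀ hC]
          linarith
        linarith
      obtain ⟨t, ht, hts⟩ := intermediate_value_Icc hmb
        (hFc.mono fun x hx ↦ hm.trans_le hx.1) ⟨hs.le, hb⟩
      exact ⟨t, fun _ ↦ ⟨hm.trans_le ht.1, hts⟩⟩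
    · exact ⟨0, fun h ↦ absurd h hs⟩
  choose τ hτ using hsurj
  have hτ₁ : τ 0 = t₁ := by
    have h0 := hτ 0 (by linarith)
    have := hinj (τ 0) t₁ h0.1 ht₁
    rw [h0.2, hF₁, sub_self, abs_zero, mul_zero] at this
    exact sub_eq_zero.1 (abs_nonpos_iff.1 this)
  refine ⟨-F m, by linarith, τ, hτ₁, fun s hs ↦ ⟨(hτ s hs).1, ?_⟩⟩
  have hcontτ : ContinuousAt τ s := by
    have hlip : ∀ᶠ u in 𝓝 s, dist (τ u) (τ s) ≤ C * dist u s := by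
      filter_upwards [Ioi_mem_nhds hs] with u hu
      have := hinj (τ u) (τ s) (hτ u hu).1 (hτ s hs).1
      rwa [(hτ u hu).2, (hτ s hs).2] at this
    refine tendsto_iff_dist_tendsto_zero.2 (squeeze_zero' (.of_forall fun _ ↦ dist_nonneg) hlip ?_)
    have : Filter.Tendsto (fun u ↦ C * dist u s) (𝓝 s) (𝓝 (C * dist s s)) :=
      (continuous_const.mul (continuous_id.dist continuous_const)).tendsto s
    simpa using this
  have := HasDerivAt.of_local_left_inverse hcontτ (hF (τ s) (hτ s hs).1)
    (inv_ne_zero (hpos _ (hτ s hs).1).ne') (by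
      filter_upwards [Ioi_mem_nhds hs] with u hu using (hτ u hu).2)
  rwa [Pi.inv_apply, inv_inv] at this

/-- A solution of a first-order equation with `C¹` right-hand side is `C²`. -/
theorem contDiffOn_two_of_hasDerivAt {τ g : ℝ → ℝ} {S : Set ℝ} (hS : IsOpen S)
    (hτ : ∀ s ∈ S, HasDerivAt τ (g s) s) (hg : ContDiffOn ℝ 1 g S) : ContDiffOn ℝ 2 τ S := by
  rw [show (2 : WithTop ℕ∞) = 1 + 1 by norm_num, contDiffOn_succ_iff_deriv_of_isOpen hS]
  exact ⟨fun t ht ↦ (hτ t ht).differentiableAt.differentiableWithinAt, by simp,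
    hg.congr fun t ht ↦ (hτ t ht).deriv⟩

end ScalarEquations

/-! ### Causal geodesic completeness -/

section Completeness

variable {n : ℕ} {M : Type*} [TopologicalSpace M] [ChartedSpace (EuclideanSpace ℝ (Fin n)) M]
  [IsManifold (𝓡 n) ∞ M]

/-- A geodesic with future-directed causal initial velocity `(v, θ)` at `(x, t₁)` runs over the
slice geodesic `c` with velocity `v` as `s ↦ (c (f s), τ s)`, where `f' = a(t₁)² / a(τ)²`. With
`e = σ(v, v)`, conservation of the length of its velocity turns the equation for `τ` into
`τ' = √(θ² - a(t₁)² e + a(t₁)⁴ e / a(τ)²)`. The right-hand side is bounded, since `e / a²` is. -/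
theorem geodesicForever_of_isFutureCausal [T2Space M] (U : Universe n M)
    (hglob : GloballyHyperbolic U.metric U.timeForm) (hreg : U.slice.RegularlyHyperbolic)
    (X : TangentBundle ((𝓡 n).prod 𝓘(ℝ, ℝ)) (M × timeAxis U.t₀))
    (hX : IsFutureCausal U.metric U.timeForm X) : GeodesicForever U.metric X := by
  obtain ⟨⟨x, ⟨t₁, ht₁⟩⟩, ⟨v, θ⟩⟩ := X
  obtain ⟨hcausal, hθ⟩ := hX
  change 0 < θ at hθ
  rw [U.metric_eq] at hcausal
  set Y : TangentBundle (𝓡 n) M := ⟨x, v⟩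
  change -(θ * θ) + U.a t₁ ^ 2 * energy U.σ Y ≤ 0 at hcausal
  change U.t₀ < t₁ at ht₁
  set e := energy U.σ Y
  have he : 0 ≤ e := energy_nonneg U.σ Y
  have ha₁ := U.a_pos t₁ ht₁
  obtain ⟨C, hC⟩ := exists_scale_bound U hreg Y
  obtain ⟨ε₁, hε₁, c, hc, hcv⟩ := exists_slice_geodesic U hglob hreg Y
  set P := U.a t₁ ^ 4 * e
  set E₀ := θ ^ 2 - U.a t₁ ^ 2 * e
  have hE₀ : 0 ≤ E₀ := by simp only [E₀]; linarith [sq θ]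
  have hP : 0 ≤ P := by positivity
  set h : ℝ → ℝ := fun t ↦ Real.sqrt (E₀ + P / U.a t ^ 2)
  have hrad : ∀ t > U.t₀, 0 < E₀ + P / U.a t ^ 2 := fun t ht ↦ by
    have hat := U.a_pos t ht
    rcases he.eq_or_lt with h0 | h0
    · have : E₀ = θ ^ 2 := by simp only [E₀, ← h0]; ring
      rw [this]
      positivity
    · have : 0 < P / U.a t ^ 2 := by positivity
      linarith
  have haC : ContDiffOn ℝ 1 U.a (Ioi U.t₀) := U.a_smooth.of_le ENat.LEInfty.out
  have ha0 : ∀ t ∈ Ioi U.t₀, U.a t ^ 2 ≠ 0 := fun t ht ↦ (pow_pos (U.a_pos t ht) 2).ne'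
  have hhC : ContDiffOn ℝ 1 h (Ioi U.t₀) :=
    (contDiffOn_const.add (contDiffOn_const.div (haC.pow 2) ha0)).sqrt fun t ht ↦ (hrad t ht).ne'
  have hhd : ∀ t > U.t₀, HasDerivAt h (-(P * deriv U.a t / U.a t ^ 3) / h t) t := fun t ht ↦ by
    have hat := U.a_pos t ht
    have h1 : HasDerivAt (fun t ↦ E₀ + P / U.a t ^ 2) _ t :=
      (((hasDerivAt_const t P).div ((U.hasDerivAt_a ht).pow 2) (ha0 t ht))).const_add E₀
    refine (h1.sqrt (hrad t ht).ne').congr_deriv ?_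
    have hs : Real.sqrt (E₀ + P / U.a t ^ 2) ≠ 0 := (Real.sqrt_pos.2 (hrad t ht)).ne'
    simp only [h]
    field_simp
    simp
    ring
  have hhpos : ∀ t > U.t₀, 0 < h t := fun t ht ↦ Real.sqrt_pos.2 (hrad t ht)
  have hhle : ∀ t > U.t₀, h t ≤ Real.sqrt (E₀ + U.a t₁ ^ 4 * C) := fun t ht ↦ by
    refine Real.sqrt_le_sqrt ?_
    have := mul_le_mul_of_nonneg_left (hC t ht).2 (by positivity : 0 ≤ U.a t₁ ^ 4)
    rw [← mul_div_assoc] at this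
    linarith
  obtain ⟨ε₂, hε₂, τ, hτ0, hτ⟩ := exists_autonomous_solution ht₁ hhC.continuousOn hhpos hhle
  have hτm : MapsTo τ (Ioi (-ε₂)) (Ioi U.t₀) := fun s hs ↦ (hτ s hs).1
  have hτ1 : ContDiffOn ℝ 1 τ (Ioi (-ε₂)) := by
    rw [show (1 : WithTop ℕ∞) = 0 + 1 by norm_num, contDiffOn_succ_iff_deriv_of_isOpen isOpen_Ioi]
    refine ⟨fun s hs ↦ (hτ s hs).2.differentiableAt.differentiableWithinAt, by simp, ?_⟩
    rw [contDiffOn_zero]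
    exact (hhC.continuousOn.comp (fun s hs ↦ (hτ s hs).2.continuousAt.continuousWithinAt)
      hτm).congr fun s hs ↦ (hτ s hs).2.deriv
  have hτ2 : ContDiffOn ℝ 2 τ (Ioi (-ε₂)) :=
    contDiffOn_two_of_hasDerivAt isOpen_Ioi (fun s hs ↦ (hτ s hs).2) (hhC.comp hτ1 hτm)
  set g : ℝ → ℝ := fun s ↦ U.a t₁ ^ 2 / U.a (τ s) ^ 2
  have hgC : ContDiffOn ℝ 1 g (Ioi (-ε₂)) :=
    contDiffOn_const.div ((haC.comp hτ1 hτm).pow 2) fun s hs ↦ ha0 _ (hτm hs)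
  obtain ⟨f, hf0, hf⟩ := exists_primitive (by linarith : -ε₂ < 0) hgC.continuousOn
  have hf2 : ContDiffOn ℝ 2 f (Ioi (-ε₂)) := contDiffOn_two_of_hasDerivAt isOpen_Ioi hf hgC
  have hg0 : g 0 = 1 := by simp only [g, hτ0]; exact div_self (ha0 t₁ ht₁)
  have h0 : (0 : ℝ) ∈ Ioi (-ε₂) := by simpa using hε₂
  -- the reparametrisation `f` stays in the domain of the slice geodesic near `0`
  obtain ⟨δ, hδ, hfδ⟩ := Metric.eventually_nhds_iff_ball.1
    ((hf 0 h0).continuousAt.eventually (Ioi_mem_nhds (by rw [hf0]; linarith : -ε₁ < f 0)))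
  have hfpos : ∀ s, 0 ≤ s → 0 ≤ f s := fun s hs ↦ by
    have hmono : MonotoneOn f (Ici 0) := by
      refine monotoneOn_of_deriv_nonneg (convex_Ici 0) ?_ ?_ ?_
      · exact fun u hu ↦ (hf u (h0.trans_le hu)).continuousAt.continuousWithinAt
      · rw [interior_Ici]
        exact fun u hu ↦ (hf u (lt_trans h0 hu)).differentiableAt.differentiableWithinAt
      · rw [interior_Ici]
        intro u hu
        rw [(hf u (lt_trans h0 hu)).deriv]
        positivity
    rw [← hf0]
    exact hmono self_mem_Ici hs hs
  have hdom : ∀ s > -(min ε₂ δ), -ε₂ < s ∧ -ε₁ < f s := fun s hs ↦ by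
    refine ⟨by linarith [min_le_left ε₂ δ], ?_⟩
    rcases le_total 0 s with h | h
    · linarith [hfpos s h]
    · refine hfδ s ?_
      rw [Real.ball_eq_Ioo]
      exact ⟨by linarith [min_le_right ε₂ δ], by linarith⟩
  refine ⟨min ε₂ δ, lt_min hε₂ hδ, fun s ↦ (c (f s), timeCurve U.t₀ τ s),
    isGeodesicOn_of_forall_isGeodesicAt fun s hs ↦ ?_, ?_⟩
  · obtain ⟨hs2, hs1⟩ := hdom s hs
    have hnhds : Ioi (-ε₂) ∈ 𝓝 s := Ioi_mem_nhds hs2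
    have hat := U.a_pos _ (hτ s hs2).1
    have hht := hhpos _ (hτ s hs2).1
    have hdτ : deriv τ s = h (τ s) := (hτ s hs2).2.deriv
    have hdf : deriv f s = g s := (hf s hs2).deriv
    have hddτ : deriv (deriv τ) s = -(P * deriv U.a (τ s) / U.a (τ s) ^ 3) := by
      have h1 : deriv τ =ᶠ[𝓝 s] fun s ↦ h (τ s) := by
        filter_upwards [hnhds] with u hu using (hτ u hu).2.deriv
      rw [h1.deriv_eq]
      have h2 : HasDerivAt (fun s ↦ h (τ s)) _ s :=
        (hhd _ (hτ s hs2).1).comp s (hτ s hs2).2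
      rw [h2.deriv, div_mul_cancel₀ _ hht.ne']
    have hddf : deriv (deriv f) s
        = -(2 * U.a t₁ ^ 2 * deriv U.a (τ s) * h (τ s) / U.a (τ s) ^ 3) := by
      have h1 : deriv f =ᶠ[𝓝 s] g := by
        filter_upwards [hnhds] with u hu using (hf u hu).deriv
      rw [h1.deriv_eq]
      have h2 : HasDerivAt (fun s ↦ U.a (τ s)) _ s :=
        (U.hasDerivAt_a (hτ s hs2).1).comp s (hτ s hs2).2
      have h3 : HasDerivAt g _ s :=
        (hasDerivAt_const s (U.a t₁ ^ 2)).div (h2.pow 2) (ha0 _ (hτ s hs2).1)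
      rw [h3.deriv]
      field_simp
      simp
      ring
    have henergy : energy U.σ (velocity (𝓡 n) c (f s)) = e := by
      have := energy_velocity_eq (σ := U.σ) (c := c) (a := -ε₁) (b := max (f s) 0 + 1)
        (fun t ht ↦ hc t ht.1) (s := f s) (t := 0)
        ⟨hs1, by linarith [le_max_left (f s) 0]⟩ ⟨by linarith, by linarith [le_max_right (f s) 0]⟩
      rw [this, hcv]
    refine isGeodesicAt_metric U (hc _ hs1) (hf2.contDiffAt hnhds) (hτ2.contDiffAt hnhds)
      (hτ s hs2).1 ?_ ?_
    · rw [hddf, hdτ, hdf]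
      simp only [g]
      field_simp
      ring
    · rw [hddτ, hdf, henergy]
      simp only [g, P]
      field_simp
      ring
  · have hcd : MDifferentiableAt 𝓘(ℝ, ℝ) (𝓡 n) c (f 0) :=
      (hc (f 0) (by rw [hf0]; simpa using hε₁)).1.mdifferentiableAt (by norm_num)
    have hfd := hf 0 h0
    rw [hg0] at hfd
    have hv0 : velocity (𝓡 n) (fun s ↦ c (f s)) 0 = Y := by
      rw [velocity_comp hcd hfd, one_smul, ← hcv, hf0]
      rfl
    have hτ0' : U.t₀ < τ 0 := (hτ 0 h0).1
    have hT : MDifferentiableAt 𝓘(ℝ, ℝ) 𝓘(ℝ, ℝ) (timeCurve U.t₀ τ) 0 :=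
      (contMDiffAt_timeCurve hτ0' (hτ2.contDiffAt (Ioi_mem_nhds h0))).mdifferentiableAt
        (by norm_num)
    have hcfd : MDifferentiableAt 𝓘(ℝ, ℝ) (𝓡 n) (fun s ↦ c (f s)) 0 :=
      MDifferentiableAt.comp (0 : ℝ) hcd hfd.differentiableAt.mdifferentiableAt
    have hθ' : deriv (fun s ↦ (timeCurve U.t₀ τ s : ℝ)) 0 = θ := by
      rw [(coe_timeCurve_eventuallyEq hτ0' (hτ 0 h0).2.continuousAt).deriv_eq, (hτ 0 h0).2.deriv,
        hτ0]
      simp only [h]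
      rw [show E₀ + P / U.a t₁ ^ 2 = θ ^ 2 by simp only [E₀, P]; field_simp; ring,
        Real.sqrt_sq hθ.le]
    have hT0 : timeCurve U.t₀ τ 0 = ⟨t₁, ht₁⟩ := by
      rw [timeCurve_of_lt hτ0']
      exact Subtype.ext hτ0
    have key : ∀ {Z : TangentBundle (𝓡 n) M} {t : timeAxis U.t₀} {d : ℝ},
        velocity (𝓡 n) (fun s ↦ c (f s)) 0 = Z → timeCurve U.t₀ τ 0 = t →
        deriv (fun s ↦ (timeCurve U.t₀ τ s : ℝ)) 0 = d →
        velocity ((𝓡 n).prod 𝓘(ℝ, ℝ)) (fun s ↦ (c (f s), timeCurve U.t₀ τ s)) 0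
          = ⟨(Z.1, t), (Z.2, d)⟩ := by
      rintro Z t d rfl rfl rfl
      exact velocity_prodMk hcfd hT
    exact key hv0 hT0 hθ'

end Completeness

end Friedmann

end

open scoped Manifold ContDiff in
theorem theorem1 {n : ℕ} {M : Type*} [TopologicalSpace M] [T2Space M] [SecondCountableTopology M]
    [ChartedSpace (EuclideanSpace ℝ (Fin n)) M] [IsManifold (𝓡 n) ∞ M]
    (U : Friedmann.Universe n M)
    (hglob : Friedmann.GloballyHyperbolic U.metric U.timeForm)
    (hreg : U.slice.RegularlyHyperbolic)
    (hH : ∀ t₁ : ℝ, U.t₀ < t₁ → ∃ f : ℝ → ℝ,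
      MeasureTheory.IntegrableOn f (Set.Ici t₁) ∧ ∀ t ∈ Set.Ici t₁, |U.hubble t| ≤ f t) :
    Friedmann.FutureTimelikeComplete U.metric U.timeForm ∧
      Friedmann.FutureNullComplete U.metric U.timeForm := by
  exact ⟨fun X hX ↦ Friedmann.geodesicForever_of_isFutureCausal U hglob hreg X ⟨hX.1.le, hX.2⟩,
    fun X hX ↦ Friedmann.geodesicForever_of_isFutureCausal U hglob hreg X ⟨hX.1.le, hX.2⟩⟩
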